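/- Let $n\ge 1$ and let $\Sigma\subset\mathbb R^n$ be an (embedded) $C^2$ hypersurface without boundary, i.e. every point of $\Sigma$ has an open neighbourhood $W$ with a function $\varphi\in C^2(W)$, $\nabla\varphi\neq 0$ on $W$, such that $\Sigma\cap W=\{x\in W:\varphi(x)=0\}$. Let $n_\Sigma$ be a continuous unit normal field on $\Sigma$. Write $V(r)=\omega_n|r|^n$ and $A(r)=n\,\omega_n|r|^{n-1}$, where $\omega_n$ is the volume of the unit ball of $\mathbb R^n$. (a) There are an open neighbourhood $U\subset\mathbb R^n$ of $\Sigma$ and functions $d\in C^2(U)$, $\pi\in C^1(U;\mathbb R^n)$ such that $$\Sigma=\{x\in U: d(x)=0\},\qquad |d(x)|=\operatorname{dist}(x,\Sigma),\qquad \pi(x)\in\Sigma,\qquad x=\pi(x)+d(x)\,n_\Sigma(\pi(x))\qquad (x\in U),$$ that is, $d$ is the signed distance to $\Sigma$ and $\pi$ the associated projection onto $\Sigma$. (b) Let $U,d,\pi$ be any such data, let $f^\Sigma\in C^1(\Sigma)$ and $g\in C(U)$ be real-valued, and let $\tilde U=\{x\in U:\overline B_{|d(x)|}(x)\subset U\}$,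 where $\overline B_r(x)$ is the closed ball (equal to $\{x\}$ for $r=0$). Then $\tilde U$ is an open neighbourhood of $\Sigma$. Define $f:\tilde U\to\mathbb R$ by $f(x)=f^\Sigma(x)$ for $x\in\Sigma$ and $$f(x)=f^\Sigma(\pi(x))-\frac{d(x)}{V(d(x))}\int_{\|x-y\|\le|d(x)|}g(y)\,dy\qquad\text{for }x\in\tilde U\setminus\Sigma.$$ Then $f^\Sigma\circ\pi\in C^1(U)$ and: 1. For all $x\in\tilde U\setminus\Sigma$ the function $f$ is differentiable at $x$ and, for $k=1,\dots,n$, $$\begin{aligned}\partial_kf(x)={}&\partial_k(f^\Sigma\circ\pi)(x)+\partial_kd(x)\,\frac{n-1}{V(d(x))}\int_{\|x-y\|\le|d(x)|}g(y)\,dy\\&-\partial_kd(x)\,\frac{n}{A(d(x))}\int_{\|x-y\|=|d(x)|}g(y)\,do(y)+\frac{n}{A(d(x))}\int_{\|x-y\|=|d(x)|}g(y)\,\frac{x_k-y_k}{d(x)}\,do(y),\end{aligned}$$ where $do$ is the surface measure of the sphere. 2. For all $x\in\Sigma$ the function $f$ is differentiable at $x$ and $\nabla f(x)=\nabla_\Sigma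 f^\Sigma(x)-g(x)\,n_\Sigma(x)$, where $\nabla_\Sigma f^\Sigma(x)$ denotes the surface gradient of $f^\Sigma$, i.e. the component orthogonal to $n_\Sigma(x)$ of the gradient at $x$ of any local $C^1$ extension of $f^\Sigma$. 3. $f\in C^1(\tilde U)$. -/

import Mathlib

open MeasureTheory Set Metric

noncomputable section

namespace SurfaceExtension

/-- Euclidean space `ℝⁿ`. -/
abbrev E (n : ℕ) : Type := EuclideanSpace ℝ (Fin n)

/-- `φ` is a `C²` level set representation of `S` on the open set `W`: the gradient of `φ` has no
zero on `W`, and `S ∩ W` is the zero set of `φ` in `W`. -/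
structure IsLevelSetRep {n : ℕ} (S W : Set (E n)) (φ : E n → ℝ) : Prop where
  isOpen : IsOpen W
  contDiffOn : ContDiffOn ℝ 2 φ W
  gradient_ne_zero : ∀ x ∈ W, gradient φ x ≠ 0
  inter_eq : S ∩ W = {x ∈ W | φ x = 0}

/-- `S` is an (embedded) `C²` hypersurface without boundary in `ℝⁿ`. It need be neither compact nor
connected nor a closed subset of `ℝⁿ`. -/
def IsC2Hypersurface {n : ℕ} (S : Set (E n)) : Prop :=
  ∀ p ∈ S, ∃ (W : Set (E n)) (φ : E n → ℝ), p ∈ W ∧ IsLevelSetRep S W φ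

/-- `ν` is a (continuous) unit normal field of the hypersurface `S`; the normal line at a point is
spanned by the gradient of a level set representation. Only the values on `S` matter. -/
structure IsUnitNormalField {n : ℕ} (S : Set (E n)) (ν : E n → E n) : Prop where
  continuousOn : ContinuousOn ν S
  norm_eq_one : ∀ p ∈ S, ‖ν p‖ = 1
  mem_normal_line : ∀ p ∈ S, ∀ (W : Set (E n)) (φ : E n → ℝ), p ∈ W → IsLevelSetRep S W φ →
    ν p ∈ Submodule.span ℝ {gradient φ p}

/-- `f ∈ C¹(S)`: near each point of `S`, the function `f` is the restriction to `S` of a `C¹`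
function on an open subset of `ℝⁿ`. Only the values of `f` on `S` matter. -/
def IsC1OnSurface {n : ℕ} (S : Set (E n)) (f : E n → ℝ) : Prop :=
  ∀ p ∈ S, ∃ (W : Set (E n)) (F : E n → ℝ),
    IsOpen W ∧ p ∈ W ∧ ContDiffOn ℝ 1 F W ∧ EqOn F f (S ∩ W)

/-- The surface gradient `∇_S f (x) = (I - ν ⊗ ν) G`, where `G` represents a derivative of `f`
along `S` at `x`, for instance the gradient at `x` of a local `C¹` extension of `f`. Two such `G`
differ by a multiple of `ν x`, so that the tangential part does not depend on the choice. Only the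
values of `f` on `S` matter when `x ∈ S`. -/
def surfaceGradient {n : ℕ} (S : Set (E n)) (ν : E n → E n) (f : E n → ℝ) (x : E n) : E n :=
  gradientWithin f S x - (inner ℝ (ν x) (gradientWithin f S x)) • ν x

/-- `U` is an open neighbourhood of `S` on which the signed distance `d` to `S` (positive on the
side of `ν`) is `C²` and vanishes exactly on `S`, with associated projection `P` onto `S`, which is
`C¹` and satisfies `x = P x + d x • ν (P x)`. -/
structure IsSignedDistanceNhd {n : ℕ} (S : Set (E n)) (ν : E n → E n) (U : Set (E n))
    (d : E n → ℝ) (P : E n → E n) : Prop where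
  isOpen : IsOpen U
  level_set : S = {x ∈ U | d x = 0}
  contDiffOn_dist : ContDiffOn ℝ 2 d U
  contDiffOn_proj : ContDiffOn ℝ 1 P U
  abs_dist : ∀ x ∈ U, |d x| = infDist x S
  proj_mem : ∀ x ∈ U, P x ∈ S
  eq_proj_add : ∀ x ∈ U, x = P x + d x • ν (P x)

/-- `ω_n`, the volume of the unit ball of `ℝⁿ`. -/
def unitBallVolume (n : ℕ) : ℝ := volume.real (ball (0 : E n) 1)

/-- `V(r) = ω_n |r|ⁿ`. -/
def ballVolume (n : ℕ) (r : ℝ) : ℝ := unitBallVolume n * |r| ^ n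

/-- `A(r) = n ω_n |r|ⁿ⁻¹`. -/
def sphereArea (n : ℕ) (r : ℝ) : ℝ := n * unitBallVolume n * |r| ^ (n - 1)

/-- The surface measure of the sphere `{y | ‖x - y‖ = r}`, `r > 0`, in `ℝⁿ`: the surface measure of
the unit sphere, transported by `z ↦ x + r z` and multiplied by `rⁿ⁻¹`. -/
def sphereMeasure {n : ℕ} (x : E n) (r : ℝ) : Measure (E n) :=
  ENNReal.ofReal (r ^ (n - 1)) •
    Measure.map (fun z : sphere (0 : E n) 1 => x + r • (z : E n)) (volume : Measure (E n)).toSphere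

/-- The partial derivative `∂_k f (x)` of a function that is differentiable at `x`. -/
def partialDeriv {n : ℕ} (k : Fin n) (f : E n → ℝ) (x : E n) : ℝ :=
  fderiv ℝ f x (EuclideanSpace.single k 1)

/-- The set of all `x ∈ U` such that the closed ball of radius `|d x|` about `x` lies in `U`. -/
def innerNhd {n : ℕ} (U : Set (E n)) (d : E n → ℝ) : Set (E n) :=
  {x ∈ U | closedBall x |d x| ⊆ U}

/-- The extension
`f(x) = f^S (P x) - d(x) / V(d(x)) * ∫_{‖x - y‖ ≤ |d(x)|} g(y) dy`. -/
def extension {n : ℕ} (d : E n → ℝ) (P : E n → E n) (fS g : E n → ℝ) (x : E n) : ℝ :=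
  fS (P x) - d x / ballVolume n (d x) * ∫ y in closedBall x |d x|, g y

end SurfaceExtension

end

/-!
**Existence of the signed distance.** Near a point of the hypersurface `S = {φ = 0}` the normal
field is `N = ∇φ / ‖∇φ‖`. The map `(y, t) ↦ (y + t N y, φ y)` has an invertible derivative at
`(p, 0)`, and its local inverse at `(x, 0)` yields the pair `(P x, d x)`. For `x` near `p` the
distance to `S` is attained, since `S` is locally compact, and by the Lagrange multiplier rule a
nearest point `q` satisfies `x = q + t N q`; so `q = P x` is the only nearest point and
`|d x|` is the distance (`IsLevelSetRep.exists_isNearestPointData`). As nearest points are unique,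
the local data glue (`exists_isSignedDistanceNhd`). The signed distance is `C²` because its
gradient `N ∘ P` is `C¹` (`hasFDerivAt_signedDist_of_eq_add_smul`).

**The extension.** Let `M g (x, r)` be the average of `g` over the ball with centre `x` and radius
`|r|` (`ballAverage`). Then `f x = fS (P x) - H (x, d x)` with `H (x, r) = r * M g (x, r)`, also on
`S`, and everything follows by the chain rule once `H` is known to be `C¹` on the whole of
`ℝⁿ × ℝ` for continuous `g` (`hasFDerivAt_snd_mul_ballAverage`, `continuous_ballAverageDeriv`).

* For `r > 0` write the integral over the ball with centre `x + h` and radius `s` in polar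
  coordinates about the *fixed* point `x`. The ball becomes `{ρ ≤ R}` with a smooth function `R` of
  direction, `h` and `s` (`polarRadius`), so that the integral can be differentiated although `g` is
  not differentiable (`hasFDerivAt_setIntegral_closedBall`). The derivative consists of integrals
  over the sphere.
* For `r < 0` use that `H` is odd in `r`.
* At `r = 0` the factor `r` vanishes and `M g` is continuous, so that the derivative is `g x dr`.
* In the rescaled form of the averages the derivative `(n A - (n - 1) M) dr + ⟪Q, dx⟫`, where `A` is
  the sphere average and `Q` the sphere moment, is visibly continuous, also at `r = 0`, where
  `A = M` and `Q = 0`.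

The statement is local, and so `g` may be replaced by a continuous function on `ℝⁿ`
(`exists_continuous_eqOn_closedBall`). On `S` the derivative of `P` is `I - ν ⊗ ∇d`, and `∇d = ν`
because `φ ∘ P = 0`; this identifies the gradient of `fS ∘ P` with the surface gradient
(`IsSignedDistanceNhd.fderiv_comp_proj_apply`).
-/

namespace SurfaceExtension

open scoped Topology Pointwise

/-! ### Balls in polar coordinates about a point near their centre -/

section PolarRadius

variable {V : Type*} [NormedAddCommGroup V] [InnerProductSpace ℝ V]

/-- For `‖h‖ < s`, the distance from the origin, in the direction of the unit vector `z`, to the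
sphere with centre `h` and radius `s`. -/
noncomputable def polarRadius (z : V) (p : V × ℝ) : ℝ :=
  inner ℝ z p.1 + √(inner ℝ z p.1 ^ 2 + p.2 ^ 2 - ‖p.1‖ ^ 2)

theorem polarRadius_pos {z : V} {p : V × ℝ} (hp : ‖p.1‖ < p.2) : 0 < polarRadius z p := by
  have h0 := norm_nonneg p.1
  have : |inner ℝ z p.1| < √(inner ℝ z p.1 ^ 2 + p.2 ^ 2 - ‖p.1‖ ^ 2) := by
    rw [← Real.sqrt_sq_eq_abs]
    exact Real.sqrt_lt_sqrt (sq_nonneg _) (by nlinarith)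
  unfold polarRadius
  linarith [neg_abs_le (inner ℝ z p.1)]

theorem smul_mem_closedBall_iff_le_polarRadius {z : V} (hz : ‖z‖ = 1) {p : V × ℝ}
    (hp : ‖p.1‖ < p.2) {ρ : ℝ} (hρ : 0 < ρ) :
    ρ • z ∈ closedBall p.1 p.2 ↔ ρ ≤ polarRadius z p := by
  have h0 := norm_nonneg p.1
  set a := inner ℝ z p.1 with ha
  have hD : 0 ≤ a ^ 2 + p.2 ^ 2 - ‖p.1‖ ^ 2 := by nlinarith [sq_nonneg a]
  have hlow : a - √(a ^ 2 + p.2 ^ 2 - ‖p.1‖ ^ 2) < 0 := by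
    have : |a| < √(a ^ 2 + p.2 ^ 2 - ‖p.1‖ ^ 2) := by
      rw [← Real.sqrt_sq_eq_abs]
      exact Real.sqrt_lt_sqrt (sq_nonneg _) (by nlinarith)
    linarith [le_abs_self a]
  -- after squaring, the condition says that `ρ` lies between the roots `a ± √(a² + s² - ‖h‖²)`
  rw [mem_closedBall, dist_eq_norm, ← abs_of_nonneg (norm_nonneg _),
    ← abs_of_nonneg (h0.trans hp.le), ← sq_le_sq, norm_sub_sq_real, norm_smul, hz,
    real_inner_smul_left, ← ha, Real.norm_eq_abs, abs_of_pos hρ]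
  unfold polarRadius
  rw [← ha]
  set q := √(a ^ 2 + p.2 ^ 2 - ‖p.1‖ ^ 2)
  have hq : q ^ 2 = a ^ 2 + p.2 ^ 2 - ‖p.1‖ ^ 2 := Real.sq_sqrt hD
  constructor
  · intro h
    by_contra! hlt
    nlinarith [mul_pos (sub_pos.2 hlt) (show 0 < ρ - (a - q) by linarith)]
  · intro h
    nlinarith [mul_nonneg (sub_nonneg.2 h) (show 0 ≤ ρ - (a - q) by linarith)]

/-- The derivative of `polarRadius z` at `p`. -/
noncomputable def polarRadiusDeriv (z : V) (p : V × ℝ) : V × ℝ →L[ℝ] ℝ :=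
  (innerSL ℝ z).comp (.fst ℝ V ℝ) +
    (1 / (2 * √(inner ℝ z p.1 ^ 2 + p.2 ^ 2 - ‖p.1‖ ^ 2))) •
      ((2 * inner ℝ z p.1) • (innerSL ℝ z).comp (.fst ℝ V ℝ)
        + (2 * p.2) • .snd ℝ V ℝ - (2 : ℝ) • (innerSL ℝ p.1).comp (.fst ℝ V ℝ))

theorem hasFDerivAt_polarRadius (z : V) {p : V × ℝ} (hp : ‖p.1‖ < p.2) :
    HasFDerivAt (polarRadius z) (polarRadiusDeriv z p) p := by
  have h0 := norm_nonneg p.1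
  have h1 : HasFDerivAt (fun q : V × ℝ => inner ℝ z q.1) ((innerSL ℝ z).comp (.fst ℝ V ℝ)) p :=
    ((innerSL ℝ z).comp (.fst ℝ V ℝ)).hasFDerivAt
  have h2 : HasFDerivAt (fun q : V × ℝ => q.2) (.snd ℝ V ℝ) p := hasFDerivAt_snd
  have h3 : HasFDerivAt (fun q : V × ℝ => ‖q.1‖ ^ 2)
      ((2 : ℝ) • (innerSL ℝ p.1).comp (.fst ℝ V ℝ)) p := by
    have := (hasStrictFDerivAt_norm_sq p.1).hasFDerivAt.comp p
      (hasFDerivAt_fst (𝕜 := ℝ) (E := V) (F := ℝ) (p := p))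
    refine this.congr_fderiv ?_
    ext v <;> simp
  have hD : inner ℝ z p.1 ^ 2 + p.2 ^ 2 - ‖p.1‖ ^ 2 ≠ 0 := by
    have : 0 ≤ inner ℝ z p.1 ^ 2 := sq_nonneg _
    nlinarith
  refine (h1.add ((((h1.pow 2).add (h2.pow 2)).sub h3).sqrt hD)).congr_fderiv ?_
  unfold polarRadiusDeriv
  ext v <;> simp

theorem continuousOn_polarRadiusDeriv :
    ContinuousOn (fun q : V × (V × ℝ) => polarRadiusDeriv q.1 q.2) {q | ‖q.2.1‖ < q.2.2} := by
  unfold polarRadiusDeriv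
  have h1 : Continuous fun q : V × (V × ℝ) => innerSL ℝ q.1 := by fun_prop
  have h2 : Continuous fun q : V × (V × ℝ) => innerSL ℝ q.2.1 := by fun_prop
  have h3 : ContinuousOn (fun q : V × (V × ℝ) =>
      1 / (2 * √(inner ℝ q.1 q.2.1 ^ 2 + q.2.2 ^ 2 - ‖q.2.1‖ ^ 2))) {q | ‖q.2.1‖ < q.2.2} := by
    refine ContinuousOn.div continuousOn_const (by fun_prop) ?_
    intro q hq
    have h0 := norm_nonneg q.2.1
    have : 0 ≤ inner ℝ q.1 q.2.1 ^ 2 := sq_nonneg _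
    have hq' : ‖q.2.1‖ < q.2.2 := hq
    have : 0 < inner ℝ q.1 q.2.1 ^ 2 + q.2.2 ^ 2 - ‖q.2.1‖ ^ 2 := by nlinarith
    positivity
  have h4 : Continuous fun q : V × (V × ℝ) => (innerSL ℝ q.1).comp (.fst ℝ V ℝ) :=
    h1.clm_comp continuous_const
  have h5 : Continuous fun q : V × (V × ℝ) => (innerSL ℝ q.2.1).comp (.fst ℝ V ℝ) :=
    h2.clm_comp continuous_const
  refine h4.continuousOn.add (h3.smul (Continuous.continuousOn ?_))
  have h6 : Continuous fun q : V × (V × ℝ) => 2 * inner ℝ q.1 q.2.1 := by fun_prop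
  have h7 : Continuous fun q : V × (V × ℝ) => 2 * q.2.2 := by fun_prop
  exact ((h6.smul h4).add (h7.smul continuous_const)).sub (h5.const_smul (2 : ℝ))

theorem polarRadius_zero_left (z : V) {r : ℝ} (hr : 0 < r) : polarRadius z (0, r) = r := by
  simp [polarRadius, Real.sqrt_sq hr.le]

theorem polarRadiusDeriv_zero_left (z : V) {r : ℝ} (hr : 0 < r) :
    polarRadiusDeriv z (0, r) = (innerSL ℝ z).coprod (.id ℝ ℝ) := by
  unfold polarRadiusDeriv
  ext v
  · simp
  · simp [Real.sqrt_sq hr.le]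
    field_simp

end PolarRadius

/-! ### Differentiation of ball integrals in the centre and the radius -/

section BallIntegrals

variable {V : Type*} [NormedAddCommGroup V] [InnerProductSpace ℝ V] [FiniteDimensional ℝ V]
  [MeasurableSpace V] [BorelSpace V] (μ : Measure V) [μ.IsAddHaarMeasure]

/-- Integration in polar coordinates. -/
theorem integral_eq_integral_sphere_Ioi [Nontrivial V] {f : V → ℝ} (hf : Integrable f μ) :
    ∫ y, f y ∂μ = ∫ z : sphere (0 : V) 1,
      (∫ ρ in Ioi (0 : ℝ), ρ ^ (Module.finrank ℝ V - 1) * f (ρ • (z : V))) ∂μ.toSphere := by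
  have hmp := (μ.measurePreserving_homeomorphUnitSphereProd).symm
    (homeomorphUnitSphereProd V).toMeasurableEquiv
  have hme : MeasurableEmbedding (homeomorphUnitSphereProd V).toMeasurableEquiv.symm :=
    MeasurableEquiv.measurableEmbedding _
  have hpt : ∀ p : sphere (0 : V) 1 × Ioi (0 : ℝ),
      f ((homeomorphUnitSphereProd V).toMeasurableEquiv.symm p : ({0}ᶜ : Set V))
        = f ((p.2 : ℝ) • (p.1 : V)) := by
    intro p
    congr 1
  have h1 : ∫ y, f y ∂μ = ∫ y : ({0}ᶜ : Set V), f y ∂(μ.comap (↑)) := by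
    rw [integral_subtype_comap (measurableSet_singleton _).compl f, restrict_compl_singleton]
  have hint : Integrable (fun y : ({0}ᶜ : Set V) => f y) (μ.comap (↑)) := by
    have := (integrableOn_iff_comap_subtypeVal (μ := μ) (f := f)
      (measurableSet_singleton (0 : V)).compl).1 hf.integrableOn
    exact this
  have hint2 : Integrable (fun p : sphere (0 : V) 1 × Ioi (0 : ℝ) => f ((p.2 : ℝ) • (p.1 : V)))
      (μ.toSphere.prod (.volumeIoiPow (Module.finrank ℝ V - 1))) := by
    have := (hmp.integrable_comp_emb hme (g := fun y : ({0}ᶜ : Set V) => f y)).2 hint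
    exact this
  rw [h1, ← hmp.integral_comp hme (fun y : ({0}ᶜ : Set V) => f y)]
  simp_rw [hpt]
  rw [integral_prod _ hint2]
  refine integral_congr_ae (.of_forall fun z => ?_)
  simp only [Measure.volumeIoiPow, ENNReal.ofReal]
  rw [integral_withDensity_eq_integral_smul, integral_subtype_comap measurableSet_Ioi
    fun a ↦ Real.toNNReal (a ^ (Module.finrank ℝ V - 1)) • f (a • (z : V)),
    setIntegral_congr_fun measurableSet_Ioi fun x hx ↦ ?_]
  · rw [NNReal.smul_def, Real.coe_toNNReal _ (pow_nonneg hx.out.le _), smul_eq_mul]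
  · exact (measurable_subtype_coe.pow_const _).real_toNNReal

/-- A ball integral in polar coordinates about a point `x` that is close to the centre `x + p.1`,
and need not be the centre itself. -/
theorem setIntegral_closedBall_eq_polar [Nontrivial V] {g : V → ℝ} (hg : Continuous g) (x : V)
    {p : V × ℝ} (hp : ‖p.1‖ < p.2) :
    ∫ y in closedBall (x + p.1) p.2, g y ∂μ = ∫ z : sphere (0 : V) 1,
      (∫ ρ in (0 : ℝ)..polarRadius (z : V) p,
        ρ ^ (Module.finrank ℝ V - 1) * g (x + ρ • (z : V))) ∂μ.toSphere := by
  have h1 : ∫ y in closedBall (x + p.1) p.2, g y ∂μ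
      = ∫ y, (closedBall p.1 p.2).indicator (fun y => g (x + y)) y ∂μ := by
    rw [← integral_indicator measurableSet_closedBall, ← integral_add_left_eq_self _ x]
    refine integral_congr_ae (.of_forall fun y => ?_)
    simp only [indicator, mem_closedBall, dist_add_left]
  have hint : Integrable ((closedBall p.1 p.2).indicator (fun y => g (x + y))) μ := by
    rw [integrable_indicator_iff measurableSet_closedBall]
    exact (by fun_prop : Continuous fun y => g (x + y)).continuousOn.integrableOn_compact
      (isCompact_closedBall _ _)
  rw [h1, integral_eq_integral_sphere_Ioi μ hint]
  refine integral_congr_ae (.of_forall fun z => ?_)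
  have hz : ‖(z : V)‖ = 1 := by simp
  dsimp only
  rw [intervalIntegral.integral_of_le (polarRadius_pos hp).le,
    ← integral_indicator measurableSet_Ioc, ← integral_indicator measurableSet_Ioi]
  refine integral_congr_ae (.of_forall fun ρ => ?_)
  by_cases hρ : 0 < ρ
  · have := smul_mem_closedBall_iff_le_polarRadius hz hp hρ
    by_cases h : ρ ≤ polarRadius (z : V) p
    · have h' := this.2 h
      simp [indicator, hρ, h, mem_closedBall.1 h']
    · have h' : ¬ dist (ρ • (z : V)) p.1 ≤ p.2 := fun hh => h (this.1 hh)
      simp [indicator, hρ, h, h']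
  · simp [indicator, hρ]

/-- The key derivative: a ball integral of a merely continuous function is differentiable in the
centre and the radius, because in polar coordinates about the centre only the upper bound of the
radial integral depends on them. -/
theorem hasFDerivAt_setIntegral_closedBall [Nontrivial V] {g : V → ℝ} (hg : Continuous g)
    (x : V) {r : ℝ} (hr : 0 < r) :
    HasFDerivAt (fun p : V × ℝ => ∫ y in closedBall p.1 p.2, g y ∂μ)
      (∫ z : sphere (0 : V) 1, (r ^ (Module.finrank ℝ V - 1) * g (x + r • (z : V))) •
        (innerSL ℝ (z : V)).coprod (.id ℝ ℝ) ∂μ.toSphere) (x, r) := by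
  set m := Module.finrank ℝ V - 1
  set κ : sphere (0 : V) 1 → ℝ → ℝ := fun z ρ => ρ ^ m * g (x + ρ • (z : V)) with hκ
  have hκc : Continuous κ.uncurry := by
    simp only [hκ]; unfold Function.uncurry; fun_prop
  set Φ : V × ℝ → sphere (0 : V) 1 → ℝ := fun p z => ∫ ρ in (0 : ℝ)..polarRadius (z : V) p, κ z ρ
  set Φ' : V × ℝ → sphere (0 : V) 1 → V × ℝ →L[ℝ] ℝ := fun p z =>
    κ z (polarRadius (z : V) p) • polarRadiusDeriv (z : V) p with hΦ'
  -- on this compact neighbourhood the base point `x` lies well inside the ball, so that the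
  -- polar radius is smooth and its derivatives are uniformly bounded
  set s : Set (V × ℝ) := closedBall (0, r) (r / 4)
  have hs : ∀ p ∈ s, ‖p.1‖ < p.2 := by
    intro p hp
    have hp' : dist p (0, r) ≤ r / 4 := hp
    rw [Prod.dist_eq, max_le_iff] at hp'
    have h2 := abs_le.1 (Real.dist_eq p.2 r ▸ hp'.2)
    have h1 : ‖p.1‖ ≤ r / 4 := by simpa using hp'.1
    linarith [h2.1]
  have hpol : ∀ p : V × ℝ, Continuous fun z : sphere (0 : V) 1 => polarRadius (z : V) p := by
    intro p; unfold polarRadius; fun_prop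
  have hΦc : ∀ p, Continuous (Φ p) := fun p =>
    intervalIntegral.continuous_parametric_intervalIntegral_of_continuous hκc (hpol p)
  have hΦ'c : ContinuousOn (fun q : sphere (0 : V) 1 × (V × ℝ) => Φ' q.2 q.1) (univ ×ˢ s) := by
    have h1 : Continuous fun q : sphere (0 : V) 1 × (V × ℝ) =>
        κ q.1 (polarRadius (q.1 : V) q.2) := by
      have h2 : Continuous fun q : sphere (0 : V) 1 × (V × ℝ) => polarRadius (q.1 : V) q.2 := by
        unfold polarRadius
        fun_prop
      exact hκc.comp (continuous_fst.prodMk h2)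
    refine h1.continuousOn.smul ?_
    · exact continuousOn_polarRadiusDeriv.comp
        (f := fun q : sphere (0 : V) 1 × (V × ℝ) => ((q.1 : V), q.2))
        (by fun_prop) (fun q hq => hs _ hq.2)
  have hK : IsCompact ((univ : Set (sphere (0 : V) 1)) ×ˢ s) :=
    isCompact_univ.prod (isCompact_closedBall _ _)
  obtain ⟨C, hC⟩ := hK.exists_bound_of_continuousOn (E := V × ℝ →L[ℝ] ℝ) hΦ'c
  have hsn : s ∈ 𝓝 ((0 : V), r) := closedBall_mem_nhds _ (by positivity)
  have hfin : ∀ f : sphere (0 : V) 1 → ℝ, Continuous f → Integrable f μ.toSphere := fun f hf =>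
    hf.integrable_of_hasCompactSupport (HasCompactSupport.of_compactSpace f)
  have hmain : HasFDerivAt (fun p => ∫ z, Φ p z ∂μ.toSphere) (∫ z, Φ' (0, r) z ∂μ.toSphere)
      (0, r) := by
    refine hasFDerivAt_integral_of_dominated_of_fderiv_le (bound := fun _ => C) hsn
      (.of_forall fun p => (hΦc p).aestronglyMeasurable) (hfin _ (hΦc _)) ?_
      (.of_forall fun z p hp => hC (z, p) ⟨mem_univ _, hp⟩) (hfin _ continuous_const)
      (.of_forall fun z p hp => ?_)
    · refine Continuous.aestronglyMeasurable ?_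
      rw [← continuousOn_univ]
      exact hΦ'c.comp (f := fun z : sphere (0 : V) 1 => (z, ((0 : V), r))) (by fun_prop)
        (fun z _ => ⟨mem_univ _, mem_of_mem_nhds hsn⟩)
    · have hc : Continuous (κ z) := hκc.comp (by fun_prop : Continuous fun ρ => (z, ρ))
      exact (intervalIntegral.integral_hasDerivAt_right (hc.intervalIntegrable _ _)
        hc.stronglyMeasurable.stronglyMeasurableAtFilter hc.continuousAt).comp_hasFDerivAt p
        (hasFDerivAt_polarRadius (z : V) (hs p hp))
  have hΦ'0 : ∀ z : sphere (0 : V) 1, Φ' (0, r) z = (r ^ m * g (x + r • (z : V))) •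
        (innerSL ℝ (z : V)).coprod (.id ℝ ℝ) := by
    intro z
    simp only [hΦ', hκ, polarRadius_zero_left _ hr, polarRadiusDeriv_zero_left _ hr]
  simp_rw [hΦ'0] at hmain
  have hshift : HasFDerivAt (fun p : V × ℝ => (p.1 - x, p.2)) (.id ℝ (V × ℝ)) (x, r) := by
    have := (hasFDerivAt_id (𝕜 := ℝ) (x, r)).sub_const (x, (0 : ℝ))
    refine this.congr_of_eventuallyEq (.of_forall fun p => ?_)
    ext <;> simp
  have hcomp := HasFDerivAt.comp (f := fun p : V × ℝ => (p.1 - x, p.2)) (x, r)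
    (by simpa using hmain) hshift
  rw [ContinuousLinearMap.comp_id] at hcomp
  refine hcomp.congr_of_eventuallyEq ?_
  have hev : ∀ᶠ p : V × ℝ in 𝓝 (x, r), (p.1 - x, p.2) ∈ s :=
    hshift.continuousAt (by simpa using hsn)
  filter_upwards [hev] with p hp
  have := setIntegral_closedBall_eq_polar μ hg x (hs _ hp)
  simpa using this

end BallIntegrals

/-! ### Averages over balls and spheres as functions of the centre and a signed radius -/

section Averages

variable {V : Type*} [NormedAddCommGroup V] [InnerProductSpace ℝ V] [FiniteDimensional ℝ V]
  [MeasurableSpace V] (μ : Measure V) [μ.IsAddHaarMeasure]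

/-- The average of `g` over the ball with centre `p.1` and radius `|p.2|`, in a form which makes
sense for every real radius and equals `g p.1` for the radius zero. -/
noncomputable def ballAverage (g : V → ℝ) (p : V × ℝ) : ℝ :=
  (μ.real (ball (0 : V) 1))⁻¹ * ∫ z in closedBall (0 : V) 1, g (p.1 + p.2 • z) ∂μ

/-- The average of `g` over the sphere with centre `p.1` and radius `|p.2|`. -/
noncomputable def sphereAverage (g : V → ℝ) (p : V × ℝ) : ℝ :=
  (Module.finrank ℝ V * μ.real (ball (0 : V) 1))⁻¹ *
    ∫ z : sphere (0 : V) 1, g (p.1 + p.2 • (z : V)) ∂μ.toSphere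

/-- The first moment of `g` over a sphere, normalised by the volume of the unit ball: `z` stands for
`(y - p.1) / p.2`, so that the moment is odd in the radius. -/
noncomputable def sphereMoment (g : V → ℝ) (p : V × ℝ) : V :=
  (μ.real (ball (0 : V) 1))⁻¹ •
    ∫ z : sphere (0 : V) 1, g (p.1 + p.2 • (z : V)) • (z : V) ∂μ.toSphere

theorem measureReal_unitBall_pos : 0 < μ.real (ball (0 : V) 1) :=
  ENNReal.toReal_pos (measure_ball_pos μ _ one_pos).ne' measure_ball_lt_top.ne

variable [BorelSpace V]

theorem integrable_toSphere_of_continuous {F : Type*} [NormedAddCommGroup F]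
    {f : sphere (0 : V) 1 → F} (hf : Continuous f) : Integrable f μ.toSphere :=
  hf.integrable_of_hasCompactSupport (HasCompactSupport.of_compactSpace f)

theorem continuous_ballAverage {g : V → ℝ} (hg : Continuous g) : Continuous (ballAverage μ g) := by
  refine continuous_const.mul (continuous_parametric_integral_of_continuous ?_
    (isCompact_closedBall (0 : V) 1))
  unfold Function.uncurry
  fun_prop

theorem continuous_sphereAverage {g : V → ℝ} (hg : Continuous g) :
    Continuous (sphereAverage μ g) := by
  refine continuous_const.mul ?_
  simp_rw [← setIntegral_univ (μ := μ.toSphere)]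
  refine continuous_parametric_integral_of_continuous ?_ isCompact_univ
  unfold Function.uncurry
  fun_prop

theorem continuous_sphereMoment {g : V → ℝ} (hg : Continuous g) :
    Continuous (sphereMoment μ g) := by
  refine Continuous.const_smul ?_ _
  simp_rw [← setIntegral_univ (μ := μ.toSphere)]
  refine continuous_parametric_integral_of_continuous ?_ isCompact_univ
  unfold Function.uncurry
  fun_prop

theorem measurePreserving_neg_toSphere :
    MeasurePreserving (fun z : sphere (0 : V) 1 => -z) μ.toSphere μ.toSphere := by
  refine ⟨continuous_neg.measurable, Measure.ext fun s hs => ?_⟩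
  have hm : Measurable fun z : sphere (0 : V) 1 => -z := continuous_neg.measurable
  rw [Measure.map_apply hm hs, Measure.toSphere_apply' _ (hm hs), Measure.toSphere_apply' _ hs,
    ← Measure.measure_preimage_neg μ (Ioo (0 : ℝ) 1 • Subtype.val '' s)]
  congr 2
  ext y
  simp only [mem_smul, mem_image, mem_preimage]
  constructor
  · rintro ⟨t, ht, _, ⟨z, hz, rfl⟩, rfl⟩
    exact ⟨t, ht, _, ⟨-z, hz, rfl⟩, by simp⟩
  · rintro ⟨t, ht, _, ⟨z, hz, rfl⟩, h⟩
    exact ⟨t, ht, _, ⟨-z, by simpa using hz, rfl⟩, by simp [h]⟩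

theorem integral_toSphere_neg {F : Type*} [NormedAddCommGroup F] [NormedSpace ℝ F]
    (f : sphere (0 : V) 1 → F) : ∫ z, f (-z) ∂μ.toSphere = ∫ z, f z ∂μ.toSphere :=
  (measurePreserving_neg_toSphere μ).integral_comp
    (Homeomorph.neg (sphere (0 : V) 1)).measurableEmbedding f

theorem ballAverage_neg (g : V → ℝ) (x : V) (r : ℝ) :
    ballAverage μ g (x, -r) = ballAverage μ g (x, r) := by
  unfold ballAverage
  congr 1
  rw [← integral_indicator measurableSet_closedBall, ← integral_indicator measurableSet_closedBall,
    ← integral_neg_eq_self]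
  refine integral_congr_ae (.of_forall fun z => ?_)
  simp [indicator]

theorem sphereAverage_neg (g : V → ℝ) (x : V) (r : ℝ) :
    sphereAverage μ g (x, -r) = sphereAverage μ g (x, r) := by
  unfold sphereAverage
  rw [← integral_toSphere_neg]
  simp

theorem sphereMoment_neg (g : V → ℝ) (x : V) (r : ℝ) :
    sphereMoment μ g (x, -r) = -sphereMoment μ g (x, r) := by
  unfold sphereMoment
  rw [← integral_toSphere_neg, ← smul_neg, ← integral_neg]
  simp

theorem ballAverage_zero (g : V → ℝ) (x : V) : ballAverage μ g (x, 0) = g x := by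
  have h : μ.real (closedBall (0 : V) 1) = μ.real (ball (0 : V) 1) := by
    rw [Measure.real, Measure.addHaar_closedBall _ _ zero_le_one]
    simp [Measure.real]
  have := (measureReal_unitBall_pos μ).ne'
  simp only [ballAverage, zero_smul, add_zero, setIntegral_const, h, smul_eq_mul]
  field_simp

theorem sphereAverage_zero [Nontrivial V] (g : V → ℝ) (x : V) :
    sphereAverage μ g (x, 0) = g x := by
  have h1 := (measureReal_unitBall_pos μ).ne'
  have h2 : (Module.finrank ℝ V : ℝ) ≠ 0 := by exact_mod_cast Module.finrank_pos.ne'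
  simp only [sphereAverage, zero_smul, add_zero, integral_const, μ.toSphere_real_apply_univ,
    smul_eq_mul]
  field_simp

/-- An odd function of the radius vanishes at zero; equivalently, `∫ z` over the unit sphere is
zero. -/
theorem sphereMoment_zero (g : V → ℝ) (x : V) : sphereMoment μ g (x, 0) = 0 := by
  have := sphereMoment_neg μ g x 0
  rw [neg_zero] at this
  have h : (2 : ℝ) • sphereMoment μ g (x, 0) = 0 := by
    rw [two_smul]
    nth_rewrite 1 [this]
    simp
  simpa using h

theorem setIntegral_closedBall_eq_ballAverage (g : V → ℝ) (x : V) {r : ℝ} (hr : 0 < r) :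
    ∫ y in closedBall x r, g y ∂μ =
      μ.real (ball (0 : V) 1) * r ^ Module.finrank ℝ V * ballAverage μ g (x, r) := by
  have h1 := (measureReal_unitBall_pos μ).ne'
  have h2 := Measure.setIntegral_comp_smul_of_pos μ (fun y => g (x + y)) (closedBall (0 : V) 1) hr
  have h3 : r • closedBall (0 : V) 1 = closedBall 0 r := by
    rw [_root_.smul_closedBall _ _ zero_le_one]
    simp [abs_of_pos hr]
  have h4 : ∫ y in closedBall x r, g y ∂μ = ∫ y in closedBall (0 : V) r, g (x + y) ∂μ := by
    rw [← integral_indicator measurableSet_closedBall,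
      ← integral_indicator measurableSet_closedBall,
      ← integral_add_left_eq_self _ x]
    refine integral_congr_ae (.of_forall fun y => ?_)
    simp [indicator]
  unfold ballAverage
  rw [h2, h3, h4, smul_eq_mul]
  field_simp

theorem setIntegral_closedBall_abs_eq_ballAverage (g : V → ℝ) (x : V) {r : ℝ} (hr : r ≠ 0) :
    ∫ y in closedBall x |r|, g y ∂μ =
      μ.real (ball (0 : V) 1) * |r| ^ Module.finrank ℝ V * ballAverage μ g (x, r) := by
  rw [setIntegral_closedBall_eq_ballAverage μ g x (abs_pos.2 hr)]
  rcases abs_choice r with h | h <;> simp only [h, ballAverage_neg]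

/-- A product `c • m` is differentiable at a zero of the differentiable factor `c` if the other
factor `m` is merely continuous there. -/
theorem hasFDerivAt_smul_of_continuousAt {X F : Type*} [NormedAddCommGroup X] [NormedSpace ℝ X]
    [NormedAddCommGroup F] [NormedSpace ℝ F] {c : X → ℝ} {c' : X →L[ℝ] ℝ} {m : X → F} {x : X}
    (hc : HasFDerivAt c c' x) (h0 : c x = 0) (hm : ContinuousAt m x) :
    HasFDerivAt (fun y => c y • m y) (c'.smulRight (m x)) x := by
  rw [hasFDerivAt_iff_isLittleO] at hc ⊢
  have h1 : (fun y => c y) =O[𝓝 x] fun y => y - x := by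
    have h := hc.isBigO.add (c'.isBigO_sub (𝓝 x) x)
    simpa [h0] using h
  have h2 : (fun y => m y - m x) =o[𝓝 x] fun _ => (1 : ℝ) := by
    rw [Asymptotics.isLittleO_one_iff]
    exact tendsto_sub_nhds_zero_iff.2 hm
  have h3 : (fun y => c y • (m y - m x)) =o[𝓝 x] fun y => y - x := by
    refine (h1.norm_right.smul_isLittleO h2).norm_right.congr_right ?_ |>.of_norm_right
    intro y; simp
  have h4 : (fun y => (c y - c x - c' (y - x)) • m x) =o[𝓝 x] fun y => y - x := by
    refine (hc.norm_right.smul_isBigO (Asymptotics.isBigO_const_const (m x) (one_ne_zero (α := ℝ))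
      (𝓝 x))).norm_right.congr_right ?_ |>.of_norm_right
    intro y; simp
  refine (h3.add h4).congr_left fun y => ?_
  simp only [h0, ContinuousLinearMap.smulRight_apply, smul_sub, sub_smul, zero_smul, sub_zero]
  abel

/-- The derivative of `p ↦ p.2 * ballAverage μ g p` at `p`, for continuous `g`. It is continuous in
`p` also where `p.2 = 0`, since no negative power of the radius occurs in it. -/
noncomputable def ballAverageDeriv (g : V → ℝ) (p : V × ℝ) : V × ℝ →L[ℝ] ℝ :=
  (innerSL ℝ (sphereMoment μ g p)).coprod
    ((Module.finrank ℝ V * sphereAverage μ g p - (Module.finrank ℝ V - 1) * ballAverage μ g p) •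
      .id ℝ ℝ)

/-- `hasFDerivAt_setIntegral_closedBall` in terms of the sphere average and the sphere moment. -/
theorem hasFDerivAt_setIntegral_closedBall_sphereMoment [Nontrivial V] {g : V → ℝ}
    (hg : Continuous g) (x : V) {r : ℝ} (hr : 0 < r) :
    HasFDerivAt (fun p : V × ℝ => ∫ y in closedBall p.1 p.2, g y ∂μ)
      ((μ.real (ball (0 : V) 1) * r ^ (Module.finrank ℝ V - 1)) •
        (innerSL ℝ (sphereMoment μ g (x, r))).coprod
          ((Module.finrank ℝ V * sphereAverage μ g (x, r)) • .id ℝ ℝ)) (x, r) := by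
  refine (hasFDerivAt_setIntegral_closedBall μ hg x hr).congr_fderiv ?_
  have h1 := (measureReal_unitBall_pos μ).ne'
  have h2 : (Module.finrank ℝ V : ℝ) ≠ 0 := by exact_mod_cast Module.finrank_pos.ne'
  have hL : Continuous fun z : sphere (0 : V) 1 => (innerSL ℝ (z : V)).coprod (.id ℝ ℝ) := by
    have h : Continuous fun z : sphere (0 : V) 1 => innerSL ℝ (z : V) := by fun_prop
    have h' : ∀ z : sphere (0 : V) 1, (innerSL ℝ (z : V)).coprod (.id ℝ ℝ) =
        (innerSL ℝ (z : V)).comp (.fst ℝ V ℝ) + .snd ℝ V ℝ := by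
      intro z; ext v <;> simp
    simp_rw [h']
    exact (h.clm_comp continuous_const).add continuous_const
  have hk : Continuous fun z : sphere (0 : V) 1 =>
      r ^ (Module.finrank ℝ V - 1) * g (x + r • (z : V)) := by fun_prop
  have hap : ∀ w : V × ℝ, (∫ z : sphere (0 : V) 1,
      (r ^ (Module.finrank ℝ V - 1) * g (x + r • (z : V))) •
        (innerSL ℝ (z : V)).coprod (.id ℝ ℝ) ∂μ.toSphere) w = ∫ z : sphere (0 : V) 1,
      ((r ^ (Module.finrank ℝ V - 1) * g (x + r • (z : V))) •
        (innerSL ℝ (z : V)).coprod (.id ℝ ℝ)) w ∂μ.toSphere := fun w =>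
    ContinuousLinearMap.integral_apply
      (integrable_toSphere_of_continuous μ (F := V × ℝ →L[ℝ] ℝ) (hk.smul hL)) w
  have hab : ∀ b c : ℝ, μ.real (ball (0 : V) 1) * b * ((μ.real (ball (0 : V) 1))⁻¹ * c) = b * c :=
    fun b c => by field_simp
  ext v
  · rw [ContinuousLinearMap.comp_apply, hap]
    simp only [sphereMoment, ContinuousLinearMap.inl_apply, smul_apply,
      ContinuousLinearMap.coprod_apply, map_zero, add_zero, ContinuousLinearMap.comp_apply,
      innerSL_apply_apply, real_inner_smul_left, smul_eq_mul]
    rw [real_inner_comm, ← integral_inner (integrable_toSphere_of_continuous μ (by fun_prop)),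
      hab, ← integral_const_mul]
    refine integral_congr_ae (.of_forall fun z => ?_)
    simp only [real_inner_smul_right, real_inner_comm (z : V) v]
    ring
  · rw [ContinuousLinearMap.comp_apply, hap]
    simp only [sphereAverage, ContinuousLinearMap.inr_apply, smul_apply,
      ContinuousLinearMap.coprod_apply, map_zero, zero_add, ContinuousLinearMap.comp_apply,
      ContinuousLinearMap.id_apply, smul_eq_mul, mul_one]
    rw [integral_const_mul]
    field_simp

/-- The signed radius times the ball average is differentiable everywhere, also at the radius zero,
where the derivative is `g p.1` in the direction of the radius. -/
theorem hasFDerivAt_snd_mul_ballAverage [Nontrivial V] {g : V → ℝ} (hg : Continuous g)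
    (p : V × ℝ) :
    HasFDerivAt (fun q : V × ℝ => q.2 * ballAverage μ g q) (ballAverageDeriv μ g p) p := by
  -- for positive radii the function is the ball integral divided by `ω r ^ (dim V - 1)`
  have hpos : ∀ (x : V) (r : ℝ), 0 < r → HasFDerivAt (fun q : V × ℝ => q.2 * ballAverage μ g q)
      (ballAverageDeriv μ g (x, r)) (x, r) := by
    intro x r hr
    have h1 := measureReal_unitBall_pos μ
    obtain ⟨m, hm⟩ : ∃ m, Module.finrank ℝ V = m + 1 :=
      ⟨_, (Nat.succ_pred_eq_of_pos Module.finrank_pos).symm⟩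
    have h2 := hasFDerivAt_setIntegral_closedBall_sphereMoment μ hg x hr
    have h3 : HasFDerivAt (fun q : V × ℝ => (μ.real (ball (0 : V) 1) * q.2 ^ m)⁻¹)
        ((-(μ.real (ball (0 : V) 1) * (m * r ^ (m - 1))) /
          (μ.real (ball (0 : V) 1) * r ^ m) ^ 2) • .snd ℝ V ℝ) (x, r) := by
      have := (((hasDerivAt_pow m r).const_mul (μ.real (ball (0 : V) 1))).inv
        (by positivity)).comp_hasFDerivAt (x, r) (hasFDerivAt_snd (𝕜 := ℝ) (E := V) (F := ℝ))
      exact this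
    have h4 := h3.mul h2
    refine (h4.congr_fderiv ?_).congr_of_eventuallyEq ?_
    · have h5 := setIntegral_closedBall_eq_ballAverage μ g x hr
      simp only [h5, hm, Nat.add_sub_cancel, ballAverageDeriv]
      ext v
      · simp
        field_simp
      · simp
        rcases m with _ | m
        · simp
          field_simp
        · simp
          field_simp
          ring
    · have : ∀ᶠ q : V × ℝ in 𝓝 (x, r), 0 < q.2 :=
        continuous_snd.continuousAt.eventually (lt_mem_nhds hr)
      filter_upwards [this] with q hq
      have h5 := setIntegral_closedBall_eq_ballAverage μ g q.1 hq
      simp only [Pi.mul_apply, h5, hm]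
      field_simp
      ring
  obtain ⟨x, r⟩ := p
  rcases lt_trichotomy r 0 with hr | rfl | hr
  -- the function is odd in the radius
  · have h1 := hpos x (-r) (neg_pos.2 hr)
    have h2 : HasFDerivAt (fun q : V × ℝ => (q.1, -q.2))
        ((ContinuousLinearMap.fst ℝ V ℝ).prod (-.snd ℝ V ℝ)) (x, r) :=
      hasFDerivAt_fst.prodMk hasFDerivAt_snd.neg
    have h3 := (HasFDerivAt.comp (x, r) h1 h2).neg
    refine (h3.congr_fderiv ?_).congr_of_eventuallyEq (.of_forall fun q => ?_)
    · unfold ballAverageDeriv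
      ext v <;> simp [sphereMoment_neg, sphereAverage_neg, ballAverage_neg]
    · simp [ballAverage_neg]
  -- at the radius zero the average is merely continuous, and the factor `q.2` vanishes
  · have h1 := hasFDerivAt_smul_of_continuousAt (hasFDerivAt_snd (𝕜 := ℝ) (E := V) (F := ℝ)
      (p := (x, (0 : ℝ)))) rfl (continuous_ballAverage μ hg).continuousAt
    refine h1.congr_fderiv ?_
    unfold ballAverageDeriv
    ext v
    · simp [sphereMoment_zero]
    · simp [sphereAverage_zero, ballAverage_zero]
      ring
  · exact hpos x r hr

theorem continuous_ballAverageDeriv {g : V → ℝ} (hg : Continuous g) :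
    Continuous (ballAverageDeriv μ g) := by
  have h : ∀ p, ballAverageDeriv μ g p = (innerSL ℝ (sphereMoment μ g p)).comp (.fst ℝ V ℝ) +
      (Module.finrank ℝ V * sphereAverage μ g p - (Module.finrank ℝ V - 1) * ballAverage μ g p) •
        .snd ℝ V ℝ := by
    intro p; unfold ballAverageDeriv; ext v <;> simp
  have h1 : Continuous fun p => innerSL ℝ (sphereMoment μ g p) :=
    (innerSL ℝ).continuous.comp (continuous_sphereMoment μ hg)
  have h2 := continuous_sphereAverage μ hg
  have h3 := continuous_ballAverage μ hg
  rw [funext h]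
  have h4 : Continuous fun p => Module.finrank ℝ V * sphereAverage μ g p -
      (Module.finrank ℝ V - 1) * ballAverage μ g p := by fun_prop
  exact (h1.clm_comp continuous_const).add (h4.smul continuous_const)

end Averages

/-! ### Level set representations and unit normals -/

section LevelSets

variable {n : ℕ} {S W : Set (E n)} {φ : E n → ℝ} {ν : E n → E n}

theorem IsLevelSetRep.mono {W' : Set (E n)} (h : IsLevelSetRep S W φ) (hW' : IsOpen W')
    (hsub : W' ⊆ W) : IsLevelSetRep S W' φ where
  isOpen := hW'
  contDiffOn := h.contDiffOn.mono hsub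
  gradient_ne_zero x hx := h.gradient_ne_zero x (hsub hx)
  inter_eq := by
    ext x
    have := Set.ext_iff.1 h.inter_eq x
    simp only [mem_inter_iff, mem_ofPred_eq] at this ⊢
    constructor
    · exact fun hx => ⟨hx.2, (this.1 ⟨hx.1, hsub hx.2⟩).2⟩
    · exact fun hx => ⟨(this.2 ⟨hsub hx.1, hx.2⟩).1, hx.1⟩

theorem gradient_neg (φ : E n → ℝ) (x : E n) :
    gradient (fun y => -φ y) x = -gradient φ x := by
  simp [gradient, fderiv_fun_neg]

theorem IsLevelSetRep.neg (h : IsLevelSetRep S W φ) : IsLevelSetRep S W (fun x => -φ x) where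
  isOpen := h.isOpen
  contDiffOn := h.contDiffOn.neg
  gradient_ne_zero x hx := by
    rw [gradient_neg]
    exact neg_ne_zero.2 (h.gradient_ne_zero x hx)
  inter_eq := by
    rw [h.inter_eq]
    simp

theorem IsLevelSetRep.mem_iff (h : IsLevelSetRep S W φ) {x : E n} (hx : x ∈ W) :
    x ∈ S ↔ φ x = 0 := by
  have := Set.ext_iff.1 h.inter_eq x
  simpa [hx] using this

theorem IsLevelSetRep.contDiffOn_gradient (h : IsLevelSetRep S W φ) :
    ContDiffOn ℝ 1 (gradient φ) W := by
  have h1 : ContDiffOn ℝ 1 (fderiv ℝ φ) W :=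
    h.contDiffOn.fderiv_of_isOpen h.isOpen (by norm_num)
  exact (InnerProductSpace.toDual ℝ (E n)).symm.contDiff.comp_contDiffOn h1

theorem IsLevelSetRep.hasGradientAt (h : IsLevelSetRep S W φ) {x : E n} (hx : x ∈ W) :
    HasGradientAt φ (gradient φ x) x :=
  ((h.contDiffOn.differentiableOn (by norm_num)).differentiableAt
    (h.isOpen.mem_nhds hx)).hasGradientAt

/-- The normalised gradient of `φ`. -/
noncomputable def unitGradient (φ : E n → ℝ) (x : E n) : E n := ‖gradient φ x‖⁻¹ • gradient φ x

theorem IsLevelSetRep.norm_unitGradient (h : IsLevelSetRep S W φ) {x : E n} (hx : x ∈ W) :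
    ‖unitGradient φ x‖ = 1 := by
  have := norm_ne_zero_iff.2 (h.gradient_ne_zero x hx)
  simp [unitGradient, norm_smul, this]

theorem IsLevelSetRep.contDiffOn_unitGradient (h : IsLevelSetRep S W φ) :
    ContDiffOn ℝ 1 (unitGradient φ) W := by
  have h1 := h.contDiffOn_gradient
  exact ((h1.norm ℝ h.gradient_ne_zero).inv
    fun x hx => norm_ne_zero_iff.2 (h.gradient_ne_zero x hx)).smul h1

/-- A unit normal field is locally the normalised gradient of a level set representation: its sign
relative to a given representation is locally constant by continuity. -/
theorem exists_isLevelSetRep_eq_unitGradient (hS : IsC2Hypersurface S)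
    (hν : IsUnitNormalField S ν) {p : E n} (hp : p ∈ S) :
    ∃ (W : Set (E n)) (φ : E n → ℝ), p ∈ W ∧ IsLevelSetRep S W φ ∧
      ∀ q ∈ S ∩ W, ν q = unitGradient φ q := by
  obtain ⟨W, φ, hpW, h⟩ := hS p hp
  wlog hpos : 0 < inner ℝ (ν p) (gradient φ p) generalizing φ
  · refine this (fun x => -φ x) h.neg ?_
    rw [gradient_neg, inner_neg_right, neg_pos]
    refine lt_of_le_of_ne (not_lt.1 hpos) fun h0 => ?_
    obtain ⟨c, hc⟩ := Submodule.mem_span_singleton.1 (hν.mem_normal_line p hp W φ hpW h)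
    have h1 := hν.norm_eq_one p hp
    rw [← hc, real_inner_smul_left, real_inner_self_eq_norm_sq] at h0
    have h2 := norm_ne_zero_iff.2 (h.gradient_ne_zero p hpW)
    have hc0 : c = 0 := by simpa [h2] using h0
    rw [← hc, hc0] at h1
    simp at h1
  have hcont : ContinuousOn (fun q => inner ℝ (ν q) (gradient φ q)) (S ∩ W) :=
    (hν.continuousOn.mono inter_subset_left).inner
      (h.contDiffOn_gradient.continuousOn.mono inter_subset_right)
  have hev : ∀ᶠ q in 𝓝[S ∩ W] p, 0 < inner ℝ (ν q) (gradient φ q) :=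
    (hcont p ⟨hp, hpW⟩).eventually (lt_mem_nhds hpos)
  obtain ⟨O, hO, hpO, hOsub⟩ := mem_nhdsWithin.1 hev
  refine ⟨O ∩ W, φ, ⟨hpO, hpW⟩, h.mono (hO.inter h.isOpen) inter_subset_right, ?_⟩
  rintro q ⟨hqS, hqO, hqW⟩
  have hq : 0 < inner ℝ (ν q) (gradient φ q) := hOsub ⟨hqO, hqS, hqW⟩
  obtain ⟨c, hc⟩ := Submodule.mem_span_singleton.1 (hν.mem_normal_line q hqS W φ hqW h)
  have h1 := hν.norm_eq_one q hqS
  rw [← hc, real_inner_smul_left, real_inner_self_eq_norm_sq] at hq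
  have hc0 : 0 < c := pos_of_mul_pos_left hq (sq_nonneg _)
  rw [← hc, norm_smul, Real.norm_eq_abs, abs_of_pos hc0] at h1
  rw [← hc, unitGradient, eq_inv_of_mul_eq_one_left h1]

end LevelSets

/-! ### Existence of the signed distance and the projection -/

section Projection

variable {n : ℕ} {S W : Set (E n)} {φ : E n → ℝ} {ν : E n → E n}

/-- A point of a level set that is nearest to `x` has `x` on its normal line, by the Lagrange
multiplier rule. -/
theorem IsLevelSetRep.eq_add_smul_unitGradient (h : IsLevelSetRep S W φ) {x q : E n}
    (hqS : q ∈ S) (hqW : q ∈ W) (hmin : dist x q = infDist x S) :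
    ∃ t : ℝ, |t| = dist x q ∧ x = q + t • unitGradient φ q := by
  have hφq := (h.mem_iff hqW).1 hqS
  have hextr : IsLocalExtrOn (fun y => ‖y - x‖ ^ 2) {y | φ y = φ q} q := by
    refine Or.inl ?_
    have hW : W ∈ 𝓝[{y | φ y = φ q}] q := mem_nhdsWithin_of_mem_nhds (h.isOpen.mem_nhds hqW)
    filter_upwards [hW, self_mem_nhdsWithin] with y hyW hy
    have hyS : y ∈ S := (h.mem_iff hyW).2 (by rw [← hφq]; exact hy)
    have : dist x q ≤ dist x y := hmin ▸ infDist_le_dist_of_mem hyS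
    rw [dist_comm x q, dist_comm x y, dist_eq_norm, dist_eq_norm] at this
    gcongr
  have hφ' : HasStrictFDerivAt φ (InnerProductSpace.toDual ℝ _ (gradient φ q)) q := by
    have h1 := (h.contDiffOn.contDiffAt (h.isOpen.mem_nhds hqW)).hasStrictFDerivAt (by norm_num)
    rwa [(h.hasGradientAt hqW).hasFDerivAt.fderiv] at h1
  have hn : HasStrictFDerivAt (fun y => ‖y - x‖ ^ 2) ((2 : ℝ) • innerSL ℝ (q - x)) q := by
    have h1 := (hasStrictFDerivAt_norm_sq (q - x)).comp q
      ((hasStrictFDerivAt_id (𝕜 := ℝ) q).sub_const x)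
    refine h1.congr_fderiv ?_
    ext v; simp
  obtain ⟨a, b, hab, hL⟩ := hextr.exists_multipliers_of_hasStrictFDerivAt_1d hφ' hn
  have hg := h.gradient_ne_zero q hqW
  have hg' := norm_ne_zero_iff.2 hg
  have hvec : a • gradient φ q + (b * 2) • (q - x) = 0 := by
    refine ext_inner_right ℝ fun v => ?_
    have := DFunLike.congr_fun hL v
    simp only [add_apply, smul_apply, smul_eq_mul, InnerProductSpace.toDual_apply_apply,
      innerSL_apply_apply, zero_apply] at this
    rw [inner_add_left, real_inner_smul_left, real_inner_smul_left, inner_zero_left]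
    linarith
  have hb : b ≠ 0 := by
    rintro rfl
    have : a = 0 := by simpa [hg] using hvec
    exact hab (by simp [this])
  have hx : x = q + (a / (b * 2) * ‖gradient φ q‖) • unitGradient φ q := by
    rw [unitGradient, smul_smul, mul_assoc, mul_inv_cancel₀ hg', mul_one]
    have h2 : (b * 2) • x = (b * 2) • (q + (a / (b * 2)) • gradient φ q) := by
      rw [smul_add, smul_smul, mul_div_cancel₀ _ (by simpa using hb)]
      have := hvec
      rw [smul_sub] at this
      rw [← sub_eq_zero, ← neg_eq_zero, ← this]
      abel
    exact smul_right_injective _ (by simpa using hb : b * 2 ≠ 0) h2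
  refine ⟨_, ?_, hx⟩
  rw [dist_comm, dist_eq_norm]
  nth_rewrite 1 [hx]
  rw [sub_add_cancel_left, norm_neg, norm_smul, h.norm_unitGradient hqW, mul_one, Real.norm_eq_abs]

/-- The gradient of the signed distance `d` at `x` is the unit normal `m x` at the projection of
`x`: in the derivative of `y = P y + d y • m y` at `x`, the terms with `DP` and `Dm` are orthogonal
to `m x`. Since `m` is as smooth as `P`, the signed distance gains one derivative. -/
theorem hasFDerivAt_signedDist_of_eq_add_smul {d : E n → ℝ} {P m : E n → E n} {x : E n}
    (hd : DifferentiableAt ℝ d x) (hP : DifferentiableAt ℝ P x) (hm : DifferentiableAt ℝ m x)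
    (hnorm : ∀ᶠ y in 𝓝 x, ‖m y‖ = 1) (heq : ∀ᶠ y in 𝓝 x, y = P y + d y • m y)
    {φ : E n → ℝ} {c : ℝ} (hc : c ≠ 0) (hφ : HasGradientAt φ (c • m x) (P x))
    (hφP : ∀ᶠ y in 𝓝 x, φ (P y) = 0) : HasFDerivAt d (innerSL ℝ (m x)) x := by
  have h1 : HasFDerivAt (fun y => φ (P y)) (0 : E n →L[ℝ] ℝ) x :=
    (hasFDerivAt_const (0 : ℝ) x).congr_of_eventuallyEq hφP
  have h2 := h1.unique (hφ.hasFDerivAt.comp x hP.hasFDerivAt)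
  have h3 : HasFDerivAt (fun y => inner ℝ (m y) (m y)) (0 : E n →L[ℝ] ℝ) x := by
    refine (hasFDerivAt_const (1 : ℝ) x).congr_of_eventuallyEq ?_
    filter_upwards [hnorm] with y hy
    rw [real_inner_self_eq_norm_sq, hy]
    norm_num
  have h4 := h3.unique (hm.hasFDerivAt.inner ℝ hm.hasFDerivAt)
  have h5 := ((hasFDerivAt_id (𝕜 := ℝ) x).congr_of_eventuallyEq
    (heq.mono fun y hy => hy.symm)).unique (hP.hasFDerivAt.add (hd.hasFDerivAt.smul hm.hasFDerivAt))
  refine hd.hasFDerivAt.congr_fderiv ?_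
  ext v
  have e2 := DFunLike.congr_fun h2 v
  have e4 := DFunLike.congr_fun h4 v
  have e5 := congrArg (inner ℝ (m x)) (DFunLike.congr_fun h5 v)
  have hmx : inner ℝ (m x) (m x) = 1 := by
    rw [real_inner_self_eq_norm_sq, hnorm.self_of_nhds]
    norm_num
  simp only [ContinuousLinearMap.comp_apply, InnerProductSpace.toDual_apply_apply, zero_apply,
    real_inner_smul_left, zero_eq_mul, hc, false_or] at e2
  simp [fderivInnerCLM_apply, real_inner_comm (m x)] at e4
  have e4' : inner ℝ (m x) (fderiv ℝ m x v) = 0 := by linarith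
  simp only [ContinuousLinearMap.id_apply, add_apply, smul_apply,
    ContinuousLinearMap.smulRight_apply, inner_add_right, real_inner_smul_right, e2, e4', hmx,
    mul_zero, mul_one, zero_add] at e5
  exact e5.symm

/-- The inverse function theorem in finite dimension, where an injective derivative suffices. -/
theorem exists_contDiffAt_inverse {X : Type*} [NormedAddCommGroup X] [NormedSpace ℝ X]
    [FiniteDimensional ℝ X] {Ψ : X → X} {Ψ' : X →L[ℝ] X} {a : X} (hΨ : ContDiffAt ℝ 1 Ψ a)
    (hΨ' : HasFDerivAt Ψ Ψ' a) (hinj : Function.Injective Ψ') :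
    ∃ e : OpenPartialHomeomorph X X, a ∈ e.source ∧ (∀ y, e y = Ψ y) ∧
      ContDiffAt ℝ 1 e.symm (Ψ a) := by
  have : CompleteSpace X := FiniteDimensional.complete ℝ X
  let L : X ≃L[ℝ] X := (LinearEquiv.ofInjectiveEndo (Ψ' : X →ₗ[ℝ] X) hinj).toContinuousLinearEquiv
  have hL : HasFDerivAt Ψ (L : X →L[ℝ] X) a := by
    refine hΨ'.congr_fderiv ?_
    ext v
    rfl
  refine ⟨hΨ.toOpenPartialHomeomorph Ψ hL (by norm_num), ?_, fun y => rfl, ?_⟩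
  · exact hΨ.mem_toOpenPartialHomeomorph_source hL (by norm_num)
  · exact hΨ.to_localInverse hL (by norm_num)

/-- `U` is an open set on which every point `x` has a unique nearest point `P x` in `S`, and
`(P, d)` is the associated `C¹` projection with its `C²` signed distance. -/
structure IsNearestPointData {n : ℕ} (S : Set (E n)) (ν : E n → E n) (U : Set (E n))
    (d : E n → ℝ) (P : E n → E n) : Prop where
  isOpen : IsOpen U
  contDiffOn_dist : ContDiffOn ℝ 2 d U
  contDiffOn_proj : ContDiffOn ℝ 1 P U
  abs_dist : ∀ x ∈ U, |d x| = infDist x S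
  proj_mem : ∀ x ∈ U, P x ∈ S
  eq_proj_add : ∀ x ∈ U, x = P x + d x • ν (P x)
  dist_proj : ∀ x ∈ U, dist x (P x) = infDist x S
  proj_unique : ∀ x ∈ U, ∀ q ∈ S, dist x q = infDist x S → q = P x

/-- The projection and the signed distance near a point of `S` come from the local inverse of
`(y, t) ↦ (y + t N y, φ y)`, where `N` is the normalised gradient of `φ`. -/
theorem IsLevelSetRep.exists_isNearestPointData (h : IsLevelSetRep S W φ)
    (hνφ : ∀ q ∈ S ∩ W, ν q = unitGradient φ q) {p : E n} (hpS : p ∈ S) (hpW : p ∈ W) :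
    ∃ (U : Set (E n)) (d : E n → ℝ) (P : E n → E n), p ∈ U ∧ IsNearestPointData S ν U d P := by
  set N := unitGradient φ with hN
  have hφp : φ p = 0 := (h.mem_iff hpW).1 hpS
  have hWn : W ∈ 𝓝 p := h.isOpen.mem_nhds hpW
  have hNp : ContDiffAt ℝ 1 N p := h.contDiffOn_unitGradient.contDiffAt hWn
  set Ψ : E n × ℝ → E n × ℝ := fun y => (y.1 + y.2 • N y.1, φ y.1) with hΨdef
  have hΨ : ContDiffAt ℝ 1 Ψ (p, 0) := by
    have h1 : ContDiffAt ℝ 1 (fun y : E n × ℝ => N y.1) (p, 0) :=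
      ContDiffAt.comp (g := N) (f := Prod.fst) (p, (0 : ℝ)) hNp contDiffAt_fst
    have h2 : ContDiffAt ℝ 1 (fun y : E n × ℝ => φ y.1) (p, 0) :=
      ContDiffAt.comp (p, (0 : ℝ)) ((h.contDiffOn.contDiffAt hWn).of_le (by norm_num))
        contDiffAt_fst
    exact (contDiffAt_fst.add (contDiffAt_snd.smul h1)).prodMk h2
  have hgrad := h.gradient_ne_zero p hpW
  have hΨ' : HasFDerivAt Ψ (((ContinuousLinearMap.fst ℝ (E n) ℝ) +
      (ContinuousLinearMap.snd ℝ (E n) ℝ).smulRight (N p)).prod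
      ((innerSL ℝ (gradient φ p)).comp (.fst ℝ (E n) ℝ))) (p, 0) := by
    have h1 : HasFDerivAt (fun y : E n × ℝ => N y.1)
        ((fderiv ℝ N p).comp (.fst ℝ (E n) ℝ)) (p, 0) :=
      HasFDerivAt.comp (g := N) (f := Prod.fst) (p, (0 : ℝ))
        (hNp.differentiableAt (by norm_num)).hasFDerivAt hasFDerivAt_fst
    have h2 : HasFDerivAt (fun y : E n × ℝ => φ y.1)
        ((innerSL ℝ (gradient φ p)).comp (.fst ℝ (E n) ℝ)) (p, 0) :=
      HasFDerivAt.comp (p, (0 : ℝ)) (h.hasGradientAt hpW).hasFDerivAt hasFDerivAt_fst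
    have h3 : HasFDerivAt (fun y : E n × ℝ => y.2) (.snd ℝ (E n) ℝ) (p, 0) := hasFDerivAt_snd
    have h4 : HasFDerivAt (fun y : E n × ℝ => y.1) (.fst ℝ (E n) ℝ) (p, 0) := hasFDerivAt_fst
    refine ((h4.add (h3.smul h1)).prodMk h2).congr_fderiv ?_
    ext v <;> simp
  have hinj : Function.Injective (((ContinuousLinearMap.fst ℝ (E n) ℝ) +
      (ContinuousLinearMap.snd ℝ (E n) ℝ).smulRight (N p)).prod
      ((innerSL ℝ (gradient φ p)).comp (.fst ℝ (E n) ℝ))) := by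
    rw [injective_iff_map_eq_zero]
    rintro ⟨v, s⟩ hvs
    simp only [ContinuousLinearMap.prod_apply, add_apply, ContinuousLinearMap.coe_fst',
      ContinuousLinearMap.smulRight_apply, ContinuousLinearMap.coe_snd',
      ContinuousLinearMap.comp_apply, innerSL_apply_apply, Prod.mk_eq_zero] at hvs
    obtain ⟨h1, h2⟩ := hvs
    have h3 : v = -(s • N p) := eq_neg_of_add_eq_zero_left h1
    have h4 := norm_ne_zero_iff.2 hgrad
    have hs : s = 0 := by
      rw [h3, inner_neg_right, real_inner_smul_right, hN, unitGradient, real_inner_smul_right,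
        real_inner_self_eq_norm_sq] at h2
      simpa [h4, hgrad] using h2
    simp [h3, hs]
  obtain ⟨e, hpe, heΨ, hesymm⟩ := exists_contDiffAt_inverse hΨ hΨ' hinj
  have hΨp : Ψ (p, 0) = (p, 0) := by simp [hΨdef, hφp]
  rw [hΨp] at hesymm
  have hpt : (p, (0 : ℝ)) ∈ e.target := by
    have := e.map_source hpe
    rwa [heΨ, hΨp] at this
  have hep : e.symm (p, 0) = (p, 0) := by
    have := e.left_inv hpe
    rwa [heΨ, hΨp] at this
  -- a radius below which the minimisers stay in `W` and in the domain of injectivity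
  obtain ⟨ε, hε, hεW, hεe⟩ : ∃ ε > 0, closedBall p ε ⊆ W ∧
      ∀ q t, dist q p < ε → |t| < ε → (q, t) ∈ e.source := by
    obtain ⟨ε₁, h₁, h₁'⟩ := Metric.mem_nhds_iff.1 hWn
    obtain ⟨ε₂, h₂, h₂'⟩ := Metric.mem_nhds_iff.1 (e.open_source.mem_nhds hpe)
    refine ⟨min (ε₁ / 2) ε₂, by positivity, fun x hx => h₁' ?_, fun q t hq ht => h₂' ?_⟩
    · have : dist x p ≤ min (ε₁ / 2) ε₂ := hx
      have := this.trans (min_le_left _ _)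
      exact mem_ball.2 (by linarith)
    · rw [mem_ball, Prod.dist_eq]
      exact max_lt (hq.trans_le (min_le_right _ _))
        (by simpa using ht.trans_le (min_le_right _ _))
  have hι : Filter.Tendsto (fun x : E n => (x, (0 : ℝ))) (𝓝 p) (𝓝 (p, 0)) :=
    (Continuous.prodMk_left (0 : ℝ)).tendsto p
  have hev : ∀ᶠ x : E n in 𝓝 p, ((x, (0 : ℝ)) ∈ e.target ∧ ContDiffAt ℝ 1 e.symm (x, 0)) ∧
      (e.symm (x, 0)).1 ∈ W ∧ dist x p < ε / 2 := by
    refine ((hι.eventually (e.open_target.mem_nhds hpt)).and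
      (hι.eventually (hesymm.eventually (by norm_num)))).and (.and ?_
        (ball_mem_nhds p (by positivity)))
    have hc : ContinuousAt (fun x : E n => (e.symm (x, 0)).1) p :=
      continuous_fst.continuousAt.comp (hesymm.continuousAt.comp
        (f := fun x : E n => (x, (0 : ℝ))) (Continuous.prodMk_left (0 : ℝ)).continuousAt)
    exact hc.eventually (by simpa [hep] using hWn)
  obtain ⟨U, hU, hUo, hpU⟩ := _root_.eventually_nhds_iff.1 hev
  set d : E n → ℝ := fun x => (e.symm (x, 0)).2 with hd
  set P : E n → E n := fun x => (e.symm (x, 0)).1 with hP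
  have hinv : ∀ x ∈ U, x = P x + d x • N (P x) ∧ φ (P x) = 0 := by
    intro x hx
    have h1 := e.right_inv (hU x hx).1.1
    rw [heΨ] at h1
    exact ⟨(congrArg Prod.fst h1).symm, congrArg Prod.snd h1⟩
  have hPS : ∀ x ∈ U, P x ∈ S := fun x hx => (h.mem_iff (hU x hx).2.1).2 (hinv x hx).2
  have hνP : ∀ x ∈ U, ν (P x) = N (P x) := fun x hx => hνφ _ ⟨hPS x hx, (hU x hx).2.1⟩
  have hsymm : ∀ x ∈ U, ContDiffAt ℝ 1 (fun x : E n => e.symm (x, 0)) x := fun x hx =>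
    ContDiffAt.comp x (hU x hx).1.2 (contDiffAt_id.prodMk contDiffAt_const)
  have hdC : ∀ x ∈ U, ContDiffAt ℝ 1 d x := fun x hx => (hsymm x hx).snd
  have hPC : ∀ x ∈ U, ContDiffAt ℝ 1 P x := fun x hx => (hsymm x hx).fst
  have hNPC : ∀ x ∈ U, ContDiffAt ℝ 1 (fun y => N (P y)) x := fun x hx =>
    ContDiffAt.comp (g := N) (f := P) x
      (h.contDiffOn_unitGradient.contDiffAt (h.isOpen.mem_nhds (hU x hx).2.1)) (hPC x hx)
  have huniq : ∀ x ∈ U, ∀ q ∈ S, dist x q = infDist x S → q = P x ∧ |d x| = dist x q := by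
    intro x hx q hq hxq
    have h1 : dist x q < ε / 2 :=
      hxq ▸ (infDist_le_dist_of_mem hpS).trans_lt (hU x hx).2.2
    have h2 : dist q p < ε := by
      have := dist_triangle q x p
      rw [dist_comm q x] at this
      linarith [(hU x hx).2.2]
    have hqW : q ∈ W := hεW (mem_closedBall.2 h2.le)
    obtain ⟨t, ht, hxt⟩ := h.eq_add_smul_unitGradient hq hqW hxq
    have h3 := e.left_inv (hεe q t h2 (by linarith))
    have h4 : e (q, t) = (x, 0) := by
      rw [heΨ]
      exact Prod.ext hxt.symm ((h.mem_iff hqW).1 hq)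
    rw [h4] at h3
    exact ⟨(congrArg Prod.fst h3).symm, by rw [← ht]; exact congrArg (|·|) (congrArg Prod.snd h3)⟩
  have hex : ∀ x ∈ U, ∃ q ∈ S, dist x q = infDist x S := by
    intro x hx
    have hxp := (hU x hx).2.2
    have hK : IsCompact (closedBall p ε ∩ φ ⁻¹' {0}) :=
      (isCompact_closedBall p ε).of_isClosed_subset
        ((h.contDiffOn.continuousOn.mono hεW).preimage_isClosed_of_isClosed isClosed_closedBall
          isClosed_singleton) inter_subset_left
    have hpK : p ∈ closedBall p ε ∩ φ ⁻¹' {0} := ⟨mem_closedBall_self hε.le, hφp⟩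
    obtain ⟨q, hqK, hq⟩ := hK.exists_isMinOn ⟨p, hpK⟩
      (continuous_const.dist continuous_id : Continuous fun y => dist x y).continuousOn
    have hqS : q ∈ S := (h.mem_iff (hεW hqK.1)).2 hqK.2
    -- points of `S` outside the closed ball are farther from `x` than `p` is
    refine ⟨q, hqS, le_antisymm ((le_infDist ⟨p, hpS⟩).2 fun s hs => ?_)
      (infDist_le_dist_of_mem hqS)⟩
    by_cases hsp : s ∈ closedBall p ε
    · exact hq ⟨hsp, (h.mem_iff (hεW hsp)).1 hs⟩
    · have h1 : dist x q ≤ dist x p := hq hpK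
      rw [mem_closedBall, not_le] at hsp
      have := dist_triangle s x p
      rw [dist_comm s x] at this
      linarith
  refine ⟨U, d, P, hpU, hUo, ?_, fun x hx => (hPC x hx).contDiffWithinAt, ?_, hPS, ?_, ?_, ?_⟩
  · have hder : ∀ x ∈ U, HasFDerivAt d (innerSL ℝ (N (P x))) x := by
      intro x hx
      have hxU := hUo.mem_nhds hx
      have hne := norm_ne_zero_iff.2 (h.gradient_ne_zero _ (hU x hx).2.1)
      refine hasFDerivAt_signedDist_of_eq_add_smul (m := fun y => N (P y))
        ((hdC x hx).differentiableAt (by norm_num)) ((hPC x hx).differentiableAt (by norm_num))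
        ((hNPC x hx).differentiableAt (by norm_num)) ?_ ?_ hne (φ := φ) ?_ ?_
      · filter_upwards [hxU] with y hy using h.norm_unitGradient (hU y hy).2.1
      · filter_upwards [hxU] with y hy using (hinv y hy).1
      · rw [hN, unitGradient, smul_smul, mul_inv_cancel₀ hne, one_smul]
        exact h.hasGradientAt (hU x hx).2.1
      · filter_upwards [hxU] with y hy using (hinv y hy).2
    rw [show (2 : WithTop ℕ∞) = 1 + 1 by norm_num, contDiffOn_succ_iff_fderiv_of_isOpen hUo]
    refine ⟨fun x hx => (hder x hx).differentiableAt.differentiableWithinAt, by simp, ?_⟩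
    have h1 : ContDiffOn ℝ 1 (fun x => innerSL ℝ (N (P x))) U := fun x hx =>
      ((innerSL ℝ).contDiff.contDiffAt.comp x (hNPC x hx)).contDiffWithinAt
    exact h1.congr fun x hx => (hder x hx).fderiv
  · intro x hx
    obtain ⟨q, hq, hxq⟩ := hex x hx
    rw [(huniq x hx q hq hxq).2, hxq]
  · intro x hx
    rw [hνP x hx]
    exact (hinv x hx).1
  · intro x hx
    obtain ⟨q, hq, hxq⟩ := hex x hx
    rw [← (huniq x hx q hq hxq).1, hxq]
  · exact fun x hx q hq hxq => (huniq x hx q hq hxq).1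

/-- The local projections agree where they are defined, since nearest points are unique, and so
they glue to a projection on a neighbourhood of all of `S`. -/
theorem exists_isSignedDistanceNhd (hS : IsC2Hypersurface S) (hν : IsUnitNormalField S ν) :
    ∃ (U : Set (E n)) (d : E n → ℝ) (P : E n → E n), IsSignedDistanceNhd S ν U d P := by
  have hloc : ∀ p ∈ S, ∃ (U : Set (E n)) (d : E n → ℝ) (P : E n → E n),
      p ∈ U ∧ IsNearestPointData S ν U d P := by
    intro p hp
    obtain ⟨W, φ, hpW, h, hνφ⟩ := exists_isLevelSetRep_eq_unitGradient hS hν hp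
    exact h.exists_isNearestPointData hνφ hp hpW
  choose! U d P hpU hdata using hloc
  have hnear : ∀ x ∈ ⋃ p ∈ S, U p, ∃ q ∈ S, dist x q = infDist x S := by
    intro x hx
    obtain ⟨p, hp, hx⟩ := mem_iUnion₂.1 hx
    exact ⟨P p x, (hdata p hp).proj_mem x hx, (hdata p hp).dist_proj x hx⟩
  choose! Q hQS hQ using hnear
  have hQP : ∀ p ∈ S, ∀ x ∈ U p, Q x = P p x := fun p hp x hx =>
    (hdata p hp).proj_unique x hx _ (hQS x (mem_iUnion₂.2 ⟨p, hp, hx⟩))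
      (hQ x (mem_iUnion₂.2 ⟨p, hp, hx⟩))
  set D : E n → ℝ := fun x => inner ℝ (x - Q x) (ν (Q x)) with hD
  have hDd : ∀ p ∈ S, ∀ x ∈ U p, D x = d p x := by
    intro p hp x hx
    have h1 := (hdata p hp).eq_proj_add x hx
    have h2 : x - P p x = d p x • ν (P p x) := sub_eq_iff_eq_add'.2 h1
    simp only [hD, hQP p hp x hx, h2, real_inner_smul_left, real_inner_self_eq_norm_sq,
      hν.norm_eq_one _ ((hdata p hp).proj_mem x hx)]
    norm_num
  have hmem : ∀ {x}, x ∈ (⋃ p ∈ S, U p) → ∃ p ∈ S, x ∈ U p := fun hx => by simpa using hx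
  have habs : ∀ x ∈ ⋃ p ∈ S, U p, |D x| = infDist x S := by
    intro x hx
    obtain ⟨p, hp, hx⟩ := hmem hx
    rw [hDd p hp x hx, (hdata p hp).abs_dist x hx]
  have heq : ∀ x ∈ ⋃ p ∈ S, U p, x = Q x + D x • ν (Q x) := by
    intro x hx
    obtain ⟨p, hp, hx⟩ := hmem hx
    rw [hDd p hp x hx, hQP p hp x hx]
    exact (hdata p hp).eq_proj_add x hx
  refine ⟨⋃ p ∈ S, U p, D, Q, isOpen_biUnion fun p hp => (hdata p hp).isOpen, ?_, ?_, ?_, habs,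
    hQS, heq⟩
  · ext x
    constructor
    · intro hx
      have hxU : x ∈ ⋃ p ∈ S, U p := mem_iUnion₂.2 ⟨x, hx, hpU x hx⟩
      refine ⟨hxU, abs_eq_zero.1 ?_⟩
      rw [habs x hxU, infDist_zero_of_mem hx]
    · rintro ⟨hxU, hx⟩
      have h1 := heq x hxU
      rw [hx, zero_smul, add_zero] at h1
      rw [h1]
      exact hQS x hxU
  · intro x hx
    obtain ⟨p, hp, hx⟩ := hmem hx
    have hn := (hdata p hp).isOpen.mem_nhds hx
    refine (((hdata p hp).contDiffOn_dist.contDiffAt hn).congr_of_eventuallyEq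
      ?_).contDiffWithinAt
    filter_upwards [hn] with y hy using hDd p hp y hy
  · intro x hx
    obtain ⟨p, hp, hx⟩ := hmem hx
    have hn := (hdata p hp).isOpen.mem_nhds hx
    refine (((hdata p hp).contDiffOn_proj.contDiffAt hn).congr_of_eventuallyEq
      ?_).contDiffWithinAt
    filter_upwards [hn] with y hy using hQP p hp y hy

end Projection

/-! ### First order behaviour of a signed distance and its projection on the hypersurface -/

section SignedDistance

variable {n : ℕ} {S U : Set (E n)} {ν : E n → E n} {d : E n → ℝ} {P : E n → E n}

theorem nontrivial_of_mem_hypersurface (hS : IsC2Hypersurface S) {p : E n} (hp : p ∈ S) :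
    Nontrivial (E n) := by
  obtain ⟨W, φ, hpW, h⟩ := hS p hp
  exact nontrivial_of_ne _ 0 (h.gradient_ne_zero p hpW)

theorem IsSignedDistanceNhd.subset (h : IsSignedDistanceNhd S ν U d P) : S ⊆ U := by
  rw [h.level_set]
  exact fun x hx => hx.1

theorem IsSignedDistanceNhd.dist_eq_zero_iff (h : IsSignedDistanceNhd S ν U d P) {x : E n}
    (hx : x ∈ U) : d x = 0 ↔ x ∈ S := by
  have := Set.ext_iff.1 h.level_set x
  simp only [mem_ofPred_eq] at this
  tauto

theorem IsSignedDistanceNhd.proj_eq_self (h : IsSignedDistanceNhd S ν U d P) {x : E n}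
    (hx : x ∈ S) : P x = x := by
  have h1 := h.eq_proj_add x (h.subset hx)
  rw [(h.dist_eq_zero_iff (h.subset hx)).2 hx, zero_smul, add_zero] at h1
  exact h1.symm

theorem IsSignedDistanceNhd.contDiffAt_dist (h : IsSignedDistanceNhd S ν U d P) {x : E n}
    (hx : x ∈ U) : ContDiffAt ℝ 1 d x :=
  (h.contDiffOn_dist.contDiffAt (h.isOpen.mem_nhds hx)).of_le (by norm_num)

theorem IsSignedDistanceNhd.contDiffAt_proj (h : IsSignedDistanceNhd S ν U d P) {x : E n}
    (hx : x ∈ U) : ContDiffAt ℝ 1 P x :=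
  h.contDiffOn_proj.contDiffAt (h.isOpen.mem_nhds hx)

/-- At a point of `S` the derivative of the projection removes the component `Dd v` in the normal
direction. Only continuity of `ν` is needed, because `d` vanishes at `x`. -/
theorem IsSignedDistanceNhd.fderiv_proj_apply (h : IsSignedDistanceNhd S ν U d P)
    (hν : IsUnitNormalField S ν) {x : E n} (hx : x ∈ S) (v : E n) :
    fderiv ℝ P x v = v - fderiv ℝ d x v • ν x := by
  have hxU := h.subset hx
  have hn := h.isOpen.mem_nhds hxU
  have h1 : ContinuousAt (fun y => ν (P y)) x := by
    have h2 : Filter.Tendsto P (𝓝 x) (𝓝[S] (P x)) :=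
      tendsto_nhdsWithin_iff.2 ⟨(h.contDiffAt_proj hxU).continuousAt, by
        filter_upwards [hn] with y hy using h.proj_mem y hy⟩
    exact (hν.continuousOn (P x) (h.proj_mem x hxU)).tendsto.comp h2
  have h3 := hasFDerivAt_smul_of_continuousAt
    ((h.contDiffAt_dist hxU).differentiableAt (by norm_num)).hasFDerivAt
    ((h.dist_eq_zero_iff hxU).2 hx) h1
  rw [h.proj_eq_self hx] at h3
  have h4 : HasFDerivAt P (.id ℝ (E n) - (fderiv ℝ d x).smulRight (ν x)) x := by
    refine ((hasFDerivAt_id (𝕜 := ℝ) x).sub h3).congr_of_eventuallyEq ?_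
    filter_upwards [hn] with y hy
    exact eq_sub_of_add_eq (h.eq_proj_add y hy).symm
  simp [h4.fderiv]

/-- At a point of `S` the gradient of the signed distance is the unit normal. -/
theorem IsSignedDistanceNhd.fderiv_dist_apply (h : IsSignedDistanceNhd S ν U d P)
    (hS : IsC2Hypersurface S) (hν : IsUnitNormalField S ν) {x : E n} (hx : x ∈ S) (v : E n) :
    fderiv ℝ d x v = inner ℝ (ν x) v := by
  have hxU := h.subset hx
  obtain ⟨W, φ, hxW, hφ⟩ := hS x hx
  have hPx := h.proj_eq_self hx
  have hPc := h.contDiffAt_proj hxU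
  have hPd := (hPc.differentiableAt (by norm_num)).hasFDerivAt
  -- `φ ∘ P` vanishes near `x`, so the range of `DP` is orthogonal to the gradient of `φ`
  have h1 : HasFDerivAt (fun y => φ (P y)) (0 : E n →L[ℝ] ℝ) x := by
    refine (hasFDerivAt_const (0 : ℝ) x).congr_of_eventuallyEq ?_
    have hW : W ∈ 𝓝 (P x) := hPx.symm ▸ hφ.isOpen.mem_nhds hxW
    filter_upwards [h.isOpen.mem_nhds hxU, hPc.continuousAt hW] with y hyU hyW
    exact (hφ.mem_iff hyW).1 (h.proj_mem y hyU)
  have h2 : HasGradientAt φ (gradient φ x) (P x) := hPx.symm ▸ hφ.hasGradientAt hxW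
  have h3 := DFunLike.congr_fun (h1.unique (h2.hasFDerivAt.comp x hPd)) v
  simp only [zero_apply, ContinuousLinearMap.comp_apply, InnerProductSpace.toDual_apply_apply,
    h.fderiv_proj_apply hν hx] at h3
  obtain ⟨c, hc⟩ := Submodule.mem_span_singleton.1 (hν.mem_normal_line x hx W φ hxW hφ)
  have h4 : inner ℝ (ν x) (v - fderiv ℝ d x v • ν x) = 0 := by
    rw [← hc, real_inner_smul_left, hc, ← h3, mul_zero]
  rw [inner_sub_right, real_inner_smul_right, real_inner_self_eq_norm_sq, hν.norm_eq_one x hx] at h4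
  linarith

theorem IsSignedDistanceNhd.contDiffAt_comp_proj (h : IsSignedDistanceNhd S ν U d P)
    {fS : E n → ℝ} (hf : IsC1OnSurface S fS) {x : E n} (hx : x ∈ U) :
    ContDiffAt ℝ 1 (fun y => fS (P y)) x := by
  obtain ⟨W, F, hW, hPW, hF, hFf⟩ := hf (P x) (h.proj_mem x hx)
  have h1 : ContDiffAt ℝ 1 (fun y => F (P y)) x :=
    ContDiffAt.comp x (hF.contDiffAt (hW.mem_nhds hPW)) (h.contDiffAt_proj hx)
  refine h1.congr_of_eventuallyEq ?_
  filter_upwards [h.isOpen.mem_nhds hx,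
    (h.contDiffAt_proj hx).continuousAt (hW.mem_nhds hPW)] with y hyU hyW
  exact (hFf ⟨h.proj_mem y hyU, hyW⟩).symm

/-- The derivative of `f ∘ P` at a point of `S` is represented by the surface gradient. It does not
matter which derivative of `f` within `S` is chosen, because `P` takes its values in `S`. -/
theorem IsSignedDistanceNhd.fderiv_comp_proj_apply (h : IsSignedDistanceNhd S ν U d P)
    (hS : IsC2Hypersurface S) (hν : IsUnitNormalField S ν) {fS : E n → ℝ}
    (hf : IsC1OnSurface S fS) {x : E n} (hx : x ∈ S) (v : E n) :
    fderiv ℝ (fun y => fS (P y)) x v = inner ℝ (surfaceGradient S ν fS x) v := by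
  have hxU := h.subset hx
  have hPx := h.proj_eq_self hx
  have hPd := ((h.contDiffAt_proj hxU).differentiableAt (by norm_num)).hasFDerivAt
  have h1 : DifferentiableWithinAt ℝ fS S x := by
    obtain ⟨W, F, hW, hxW, hF, hFf⟩ := hf x hx
    have h2 : DifferentiableAt ℝ F x :=
      (hF.contDiffAt (hW.mem_nhds hxW)).differentiableAt (by norm_num)
    refine h2.differentiableWithinAt.congr_of_eventuallyEq ?_ (hFf ⟨hx, hxW⟩).symm
    filter_upwards [self_mem_nhdsWithin, mem_nhdsWithin_of_mem_nhds (hW.mem_nhds hxW)] with y h3 h4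
    exact (hFf ⟨h3, h4⟩).symm
  have h2 : HasFDerivWithinAt fS (fderivWithin ℝ fS S x) S (P x) :=
    hPx.symm ▸ h1.hasFDerivWithinAt
  have h3 : HasFDerivAt (fun y => fS (P y)) ((fderivWithin ℝ fS S x).comp (fderiv ℝ P x)) x := by
    have h4 := h2.comp x (hPd.hasFDerivWithinAt (s := U)) (fun y hy => h.proj_mem y hy)
    exact h4.hasFDerivAt (h.isOpen.mem_nhds hxU)
  have h5 : ∀ w, fderivWithin ℝ fS S x w = inner ℝ (gradientWithin fS S x) w := fun w => by
    rw [gradientWithin, InnerProductSpace.toDual_symm_apply]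
  rw [h3.fderiv, ContinuousLinearMap.comp_apply, h5, h.fderiv_proj_apply hν hx,
    h.fderiv_dist_apply hS hν hx, surfaceGradient, inner_sub_right, inner_sub_left,
    real_inner_smul_left, real_inner_smul_right, real_inner_comm (ν x)]
  ring

theorem IsSignedDistanceNhd.subset_innerNhd (h : IsSignedDistanceNhd S ν U d P) :
    S ⊆ innerNhd U d := by
  intro x hx
  have hxU := h.subset hx
  refine ⟨hxU, ?_⟩
  rw [(h.dist_eq_zero_iff hxU).2 hx, abs_zero, closedBall_zero]
  exact singleton_subset_iff.2 hxU

theorem exists_closedBall_subset_of_mem_innerNhd (hU : IsOpen U) (hd : ContinuousOn d U) {x : E n}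
    (hx : x ∈ innerNhd U d) :
    ∃ R, closedBall x R ⊆ U ∧ ∀ᶠ y in 𝓝 x, closedBall y |d y| ⊆ closedBall x R := by
  obtain ⟨δ, hδ, hδU⟩ := (isCompact_closedBall x |d x|).exists_cthickening_subset_open hU hx.2
  rw [cthickening_closedBall hδ.le (abs_nonneg _)] at hδU
  refine ⟨δ + |d x|, hδU, ?_⟩
  have h1 : ContinuousAt (fun y => |d y| + dist y x) x :=
    (hd.continuousAt (hU.mem_nhds hx.1)).abs.add (continuousAt_id.dist continuousAt_const)
  have h2 : ∀ᶠ y in 𝓝 x, |d y| + dist y x < δ + |d x| :=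
    h1.eventually (gt_mem_nhds (by simpa using hδ))
  filter_upwards [h2] with y hy
  exact closedBall_subset_closedBall' hy.le

theorem isOpen_innerNhd (hU : IsOpen U) (hd : ContinuousOn d U) : IsOpen (innerNhd U d) := by
  rw [isOpen_iff_mem_nhds]
  intro x hx
  obtain ⟨R, hRU, hR⟩ := exists_closedBall_subset_of_mem_innerNhd hU hd hx
  filter_upwards [hU.mem_nhds hx.1, hR] with y hyU hy using ⟨hyU, hy.trans hRU⟩

/-- Locally only the values of `g` on one compact ball in `U` matter, and there `g` agrees with a
globally continuous function by Tietze's theorem. -/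
theorem exists_continuous_eqOn_closedBall (hU : IsOpen U) (hd : ContinuousOn d U) {g : E n → ℝ}
    (hg : ContinuousOn g U) {x : E n} (hx : x ∈ innerNhd U d) :
    ∃ G : E n → ℝ, Continuous G ∧ ∀ᶠ y in 𝓝 x, EqOn g G (closedBall y |d y|) := by
  obtain ⟨R, hRU, hR⟩ := exists_closedBall_subset_of_mem_innerNhd hU hd hx
  obtain ⟨G, hG⟩ := ContinuousMap.exists_restrict_eq (isClosed_closedBall (x := x) (ε := R))
    ⟨(closedBall x R).domRestrict g, (hg.mono hRU).domRestrict⟩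
  refine ⟨G, G.continuous, ?_⟩
  filter_upwards [hR] with y hy
  intro z hz
  exact (DFunLike.congr_fun hG ⟨z, hy hz⟩).symm

end SignedDistance

/-! ### The extension and its derivative -/

section Extension

variable {n : ℕ} {S U : Set (E n)} {ν : E n → E n} {d : E n → ℝ} {P : E n → E n}

theorem unitBallVolume_pos : 0 < unitBallVolume n :=
  measureReal_unitBall_pos volume

theorem setIntegral_closedBall_abs_eq {g G : E n → ℝ} {x : E n} {r : ℝ} (hr : r ≠ 0)
    (hgG : EqOn g G (closedBall x |r|)) :
    ∫ y in closedBall x |r|, g y = ballVolume n r * ballAverage volume G (x, r) := by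
  rw [setIntegral_congr_fun measurableSet_closedBall hgG,
    setIntegral_closedBall_abs_eq_ballAverage volume G x hr, finrank_euclideanSpace_fin]
  rfl

theorem ballVolume_ne_zero {r : ℝ} (hr : r ≠ 0) : ballVolume n r ≠ 0 :=
  mul_ne_zero unitBallVolume_pos.ne' (pow_ne_zero _ (abs_ne_zero.2 hr))

/-- On the zero set of `d`, where `ballVolume n (d x)` may be zero, both sides are `fS (P x)`. -/
theorem extension_eq_sub_ballAverage {fS g G : E n → ℝ} {x : E n}
    (hgG : EqOn g G (closedBall x |d x|)) :
    extension d P fS g x = fS (P x) - d x * ballAverage volume G (x, d x) := by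
  unfold extension
  by_cases hd : d x = 0
  · simp [hd]
  · have := ballVolume_ne_zero (n := n) hd
    rw [setIntegral_closedBall_abs_eq hd hgG]
    field_simp

theorem integral_sphereMeasure (f : E n → ℝ) (x : E n) {r : ℝ} (hr : 0 < r) :
    ∫ y, f y ∂sphereMeasure x r = r ^ (n - 1) *
      ∫ z : sphere (0 : E n) 1, f (x + r • (z : E n)) ∂(volume : Measure (E n)).toSphere := by
  have hemb : MeasurableEmbedding fun z : sphere (0 : E n) 1 => x + r • (z : E n) := by
    refine (Continuous.isClosedEmbedding (by fun_prop) fun z w hzw => ?_).measurableEmbedding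
    exact Subtype.ext (smul_right_injective _ hr.ne' (add_left_cancel hzw))
  rw [sphereMeasure, integral_smul_measure, hemb.integral_map,
    ENNReal.toReal_ofReal (by positivity), smul_eq_mul]

theorem sphereArea_ne_zero [Nontrivial (E n)] {r : ℝ} (hr : r ≠ 0) : sphereArea n r ≠ 0 := by
  have h1 : n ≠ 0 := by
    have := Module.finrank_pos (R := ℝ) (M := E n)
    rw [finrank_euclideanSpace_fin] at this
    exact this.ne'
  exact mul_ne_zero (mul_ne_zero (by exact_mod_cast h1) unitBallVolume_pos.ne')
    (pow_ne_zero _ (abs_ne_zero.2 hr))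

theorem integral_sphereMeasure_abs_eq [Nontrivial (E n)] {g G : E n → ℝ} {x : E n} {r : ℝ}
    (hr : r ≠ 0) (hgG : EqOn g G (closedBall x |r|)) :
    ∫ y, g y ∂sphereMeasure x |r| = sphereArea n r * sphereAverage volume G (x, r) := by
  have h1 := sphereArea_ne_zero (n := n) (one_ne_zero (α := ℝ))
  have h2 : sphereAverage volume G (x, r) = sphereAverage volume G (x, |r|) := by
    rcases abs_choice r with h | h <;> simp only [h, sphereAverage_neg]
  have h3 : ∀ z : sphere (0 : E n) 1, g (x + |r| • (z : E n)) = G (x + |r| • (z : E n)) :=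
    fun z => hgG (by simp [norm_smul])
  rw [integral_sphereMeasure g x (abs_pos.2 hr), h2, sphereAverage, finrank_euclideanSpace_fin]
  simp only [sphereArea, abs_one, one_pow, mul_one] at h1 ⊢
  have hn : (n : ℝ) ≠ 0 := left_ne_zero_of_mul h1
  have hω : unitBallVolume n ≠ 0 := right_ne_zero_of_mul h1
  change _ = n * unitBallVolume n * |r| ^ (n - 1) * ((n * unitBallVolume n)⁻¹ * _)
  simp_rw [h3]
  field_simp

theorem integral_sphereMeasure_mul_eq [Nontrivial (E n)] {g G : E n → ℝ} (hG : Continuous G)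
    {x : E n} {r : ℝ} (hr : r ≠ 0) (hgG : EqOn g G (closedBall x |r|)) (k : Fin n) :
    n / sphereArea n r * ∫ y, g y * ((x k - y k) / r) ∂sphereMeasure x |r| =
      -(sphereMoment volume G (x, r) k) := by
  have h1 := sphereArea_ne_zero (n := n) hr
  have h0 : n * unitBallVolume n ≠ 0 := left_ne_zero_of_mul h1
  have h0' : (n : ℝ) ≠ 0 := left_ne_zero_of_mul h0
  have hω := (unitBallVolume_pos (n := n)).ne'
  have hp : |r| ^ (n - 1) ≠ 0 := right_ne_zero_of_mul h1
  have h2 : sphereMoment volume G (x, r) = (|r| / r) • sphereMoment volume G (x, |r|) := by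
    rcases lt_or_gt_of_ne hr with h | h
    · rw [abs_of_neg h, sphereMoment_neg, neg_div, div_self hr]
      simp
    · rw [abs_of_pos h, div_self hr, one_smul]
  have h3 : ∀ z : sphere (0 : E n) 1, g (x + |r| • (z : E n)) = G (x + |r| • (z : E n)) :=
    fun z => hgG (by simp [norm_smul])
  have h4 : ((∫ z : sphere (0 : E n) 1, G (x + |r| • (z : E n)) • (z : E n)
      ∂(volume : Measure (E n)).toSphere) : E n) k = ∫ z : sphere (0 : E n) 1,
        G (x + |r| • (z : E n)) * (z : E n) k ∂(volume : Measure (E n)).toSphere :=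
    ((EuclideanSpace.proj k : E n →L[ℝ] ℝ).integral_comp_comm
      (integrable_toSphere_of_continuous volume (by fun_prop))).symm
  have h5 : ∫ z : sphere (0 : E n) 1, g (x + |r| • (z : E n)) *
      ((x k - (x + |r| • (z : E n)) k) / r) ∂(volume : Measure (E n)).toSphere =
      -(|r| / r) * ∫ z : sphere (0 : E n) 1,
        G (x + |r| • (z : E n)) * (z : E n) k ∂(volume : Measure (E n)).toSphere := by
    rw [← integral_const_mul]
    refine integral_congr_ae (.of_forall fun z => ?_)
    simp only [h3, PiLp.add_apply, PiLp.smul_apply, smul_eq_mul]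
    ring
  rw [integral_sphereMeasure _ x (abs_pos.2 hr), h2, sphereMoment, h5]
  simp only [PiLp.smul_apply, smul_eq_mul, h4, sphereArea]
  change _ = -(|r| / r * ((unitBallVolume n)⁻¹ * _))
  field_simp

theorem contDiff_snd_mul_ballAverage [Nontrivial (E n)] {G : E n → ℝ} (hG : Continuous G) :
    ContDiff ℝ 1 (fun q : E n × ℝ => q.2 * ballAverage volume G q) := by
  rw [contDiff_one_iff_fderiv]
  refine ⟨fun q => (hasFDerivAt_snd_mul_ballAverage volume hG q).differentiableAt, ?_⟩
  rw [funext fun q => (hasFDerivAt_snd_mul_ballAverage volume hG q).fderiv]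
  exact continuous_ballAverageDeriv volume hG

theorem IsSignedDistanceNhd.extension_eventuallyEq (h : IsSignedDistanceNhd S ν U d P)
    {fS g : E n → ℝ} (hg : ContinuousOn g U) {x : E n} (hx : x ∈ innerNhd U d) :
    ∃ G : E n → ℝ, Continuous G ∧ EqOn g G (closedBall x |d x|) ∧
      extension d P fS g =ᶠ[𝓝 x] fun y => fS (P y) - d y * ballAverage volume G (y, d y) := by
  obtain ⟨G, hG, hgG⟩ := exists_continuous_eqOn_closedBall h.isOpen
    h.contDiffOn_dist.continuousOn hg hx
  exact ⟨G, hG, hgG.self_of_nhds, hgG.mono fun y hy => extension_eq_sub_ballAverage hy⟩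

theorem IsSignedDistanceNhd.contDiffAt_extension (h : IsSignedDistanceNhd S ν U d P)
    [Nontrivial (E n)] {fS g : E n → ℝ} (hf : IsC1OnSurface S fS) (hg : ContinuousOn g U)
    {x : E n} (hx : x ∈ innerNhd U d) : ContDiffAt ℝ 1 (extension d P fS g) x := by
  obtain ⟨G, hG, -, heq⟩ := h.extension_eventuallyEq (fS := fS) hg hx
  refine ContDiffAt.congr_of_eventuallyEq ((h.contDiffAt_comp_proj hf hx.1).sub ?_) heq
  exact ContDiffAt.comp (g := fun q : E n × ℝ => q.2 * ballAverage volume G q)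
    (f := fun y => (y, d y)) x (contDiff_snd_mul_ballAverage hG).contDiffAt
    (contDiffAt_id.prodMk (h.contDiffAt_dist hx.1))

/-- The derivative of the extension, in terms of a continuous function `G` on all of `ℝⁿ` that
agrees with `g` on the ball of integration. -/
theorem IsSignedDistanceNhd.exists_hasFDerivAt_extension (h : IsSignedDistanceNhd S ν U d P)
    [Nontrivial (E n)] {fS g : E n → ℝ} (hf : IsC1OnSurface S fS) (hg : ContinuousOn g U)
    {x : E n} (hx : x ∈ innerNhd U d) :
    ∃ G : E n → ℝ, Continuous G ∧ EqOn g G (closedBall x |d x|) ∧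
      HasFDerivAt (extension d P fS g) (fderiv ℝ (fun y => fS (P y)) x -
        (ballAverageDeriv volume G (x, d x)).comp
          ((ContinuousLinearMap.id ℝ (E n)).prod (fderiv ℝ d x))) x := by
  obtain ⟨G, hG, hgG, heq⟩ := h.extension_eventuallyEq (fS := fS) hg hx
  refine ⟨G, hG, hgG, HasFDerivAt.congr_of_eventuallyEq (HasFDerivAt.sub
    ((h.contDiffAt_comp_proj hf hx.1).differentiableAt (by norm_num)).hasFDerivAt ?_) heq⟩
  exact HasFDerivAt.comp (g := fun q : E n × ℝ => q.2 * ballAverage volume G q)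
    (f := fun y => (y, d y)) x (hasFDerivAt_snd_mul_ballAverage volume hG _)
    ((hasFDerivAt_id x).prodMk
      ((h.contDiffAt_dist hx.1).differentiableAt (by norm_num)).hasFDerivAt)

theorem IsSignedDistanceNhd.partialDeriv_extension (h : IsSignedDistanceNhd S ν U d P)
    [Nontrivial (E n)] {fS g : E n → ℝ} (hf : IsC1OnSurface S fS) (hg : ContinuousOn g U)
    {x : E n} (hx : x ∈ innerNhd U d) (hxS : x ∉ S) (k : Fin n) :
    partialDeriv k (extension d P fS g) x =
      partialDeriv k (fun z => fS (P z)) x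
      + partialDeriv k d x * (((n : ℝ) - 1) / ballVolume n (d x) * ∫ y in closedBall x |d x|, g y)
      - partialDeriv k d x * ((n : ℝ) / sphereArea n (d x) * ∫ y, g y ∂(sphereMeasure x |d x|))
      + (n : ℝ) / sphereArea n (d x) *
          ∫ y, g y * ((x k - y k) / d x) ∂(sphereMeasure x |d x|) := by
  have hd : d x ≠ 0 := fun h0 => hxS ((h.dist_eq_zero_iff hx.1).1 h0)
  obtain ⟨G, hG, hgG, hder⟩ := h.exists_hasFDerivAt_extension hf hg hx
  have h1 := ballVolume_ne_zero (n := n) hd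
  have h2 := sphereArea_ne_zero (n := n) hd
  rw [integral_sphereMeasure_mul_eq hG hd hgG, integral_sphereMeasure_abs_eq hd hgG,
    setIntegral_closedBall_abs_eq hd hgG]
  unfold partialDeriv
  rw [hder.fderiv]
  simp only [ballAverageDeriv, sub_apply, ContinuousLinearMap.comp_apply,
    ContinuousLinearMap.prod_apply, ContinuousLinearMap.id_apply,
    ContinuousLinearMap.coprod_apply, innerSL_apply_apply, smul_apply, smul_eq_mul,
    finrank_euclideanSpace_fin, EuclideanSpace.inner_single_right]
  simp
  field_simp
  ring

theorem IsSignedDistanceNhd.hasGradientAt_extension (h : IsSignedDistanceNhd S ν U d P)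
    (hS : IsC2Hypersurface S) (hν : IsUnitNormalField S ν)
    {fS g : E n → ℝ} (hf : IsC1OnSurface S fS) (hg : ContinuousOn g U) {x : E n} (hx : x ∈ S) :
    HasGradientAt (extension d P fS g) (surfaceGradient S ν fS x - g x • ν x) x := by
  have := nontrivial_of_mem_hypersurface hS hx
  obtain ⟨G, hG, hgG, hder⟩ := h.exists_hasFDerivAt_extension hf hg (h.subset_innerNhd hx)
  rw [hasGradientAt_iff_hasFDerivAt]
  refine hder.congr_fderiv ?_
  have hgx : g x = G x := hgG (mem_closedBall_self (abs_nonneg _))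
  ext v
  rw [(h.dist_eq_zero_iff (h.subset hx)).2 hx]
  simp only [ballAverageDeriv, sub_apply, ContinuousLinearMap.comp_apply,
    ContinuousLinearMap.prod_apply, ContinuousLinearMap.id_apply,
    ContinuousLinearMap.coprod_apply, innerSL_apply_apply, smul_apply, smul_eq_mul,
    InnerProductSpace.toDual_apply_apply, sphereMoment_zero, sphereAverage_zero, ballAverage_zero,
    inner_zero_left, inner_sub_left, real_inner_smul_left, h.fderiv_comp_proj_apply hS hν hf hx,
    h.fderiv_dist_apply hS hν hx, hgx]
  ring

end Extension

end SurfaceExtension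

theorem mainTheorem3 (n : ℕ) (S : Set (SurfaceExtension.E n))
    (ν : SurfaceExtension.E n → SurfaceExtension.E n)
    (hS : SurfaceExtension.IsC2Hypersurface S)
    (hν : SurfaceExtension.IsUnitNormalField S ν) :
    (∃ (U : Set (SurfaceExtension.E n)) (d : SurfaceExtension.E n → ℝ)
      (P : SurfaceExtension.E n → SurfaceExtension.E n),
      SurfaceExtension.IsSignedDistanceNhd S ν U d P) ∧
    ∀ (U : Set (SurfaceExtension.E n)) (d : SurfaceExtension.E n → ℝ)
      (P : SurfaceExtension.E n → SurfaceExtension.E n),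
      SurfaceExtension.IsSignedDistanceNhd S ν U d P →
    ∀ fS g : SurfaceExtension.E n → ℝ,
      SurfaceExtension.IsC1OnSurface S fS → ContinuousOn g U →
      IsOpen (SurfaceExtension.innerNhd U d) ∧
      S ⊆ SurfaceExtension.innerNhd U d ∧
      ContDiffOn ℝ 1 (fun x => fS (P x)) U ∧
      (∀ x ∈ SurfaceExtension.innerNhd U d \ S,
        DifferentiableAt ℝ (SurfaceExtension.extension d P fS g) x ∧
        ∀ k : Fin n,
          SurfaceExtension.partialDeriv k (SurfaceExtension.extension d P fS g) x =
            SurfaceExtension.partialDeriv k (fun z => fS (P z)) x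
            + SurfaceExtension.partialDeriv k d x *
                (((n : ℝ) - 1) / SurfaceExtension.ballVolume n (d x) *
                  ∫ y in closedBall x |d x|, g y)
            - SurfaceExtension.partialDeriv k d x *
                ((n : ℝ) / SurfaceExtension.sphereArea n (d x) *
                  ∫ y, g y ∂(SurfaceExtension.sphereMeasure x |d x|))
            + (n : ℝ) / SurfaceExtension.sphereArea n (d x) *
                ∫ y, g y * ((x k - y k) / d x) ∂(SurfaceExtension.sphereMeasure x |d x|)) ∧
      (∀ x ∈ S, HasGradientAt (SurfaceExtension.extension d P fS g)
        (SurfaceExtension.surfaceGradient S ν fS x - g x • ν x) x) ∧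
      ContDiffOn ℝ 1 (SurfaceExtension.extension d P fS g) (SurfaceExtension.innerNhd U d) := by
  refine ⟨SurfaceExtension.exists_isSignedDistanceNhd hS hν, fun U d P h fS g hf hg => ?_⟩
  have hnt : ∀ x ∈ SurfaceExtension.innerNhd U d, Nontrivial (SurfaceExtension.E n) :=
    fun x hx => SurfaceExtension.nontrivial_of_mem_hypersurface hS (h.proj_mem x hx.1)
  refine ⟨SurfaceExtension.isOpen_innerNhd h.isOpen h.contDiffOn_dist.continuousOn,
    h.subset_innerNhd, fun x hx => (h.contDiffAt_comp_proj hf hx).contDiffWithinAt, ?_,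
    fun x hx => h.hasGradientAt_extension hS hν hf hg hx, ?_⟩
  · rintro x ⟨hx, hxS⟩
    have := hnt x hx
    exact ⟨(h.contDiffAt_extension hf hg hx).differentiableAt (by norm_num),
      fun k => h.partialDeriv_extension hf hg hx hxS k⟩
  · intro x hx
    have := hnt x hx
    exact (h.contDiffAt_extension hf hg hx).contDiffWithinAt
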